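/- Let $\mu$ be a partition, identified with its Young diagram, whose rows and columns are indexed from $0$, and let $n_0\ge n_1\ge\cdots\ge n_d\ge 1$ be the lengths of its columns, i.e. $\mu'=(n_0,\ldots,n_d)$ is the conjugate partition (so $\mu$ has $n_0$ rows and $d+1$ columns, and $\mu'$ has $d+1$ rows). Let $N\ge n_0$ be an integer. Choose the following three objects, each uniformly at random. 1. $a$, among all fillings of $\mu$ by positive integers that increase strictly down each column and whose entries in column $i$ are at most $N+i$, for every $i$. 2. $b$, among all fillings of $\mu'$ by positive integers that increase weakly along each row and whose entries in row $j$ are greater than $j$ and at most $d+1$, for every $j$. 3. $c$, among all fillings of $\mu$ that use each of the numbers $1,\ldots,|\mu|$ exactly once and increase down each column. Then $$\Pr\big(a\text{ is a semistandard Young tableau of shape }\mu\text{ with entries in }\{1,\ldots,N\}\big)=\Pr\big(b\text{ is a semistandard Young tableau of shape }\mu'\text{ with entries in }\{1,\ldots,d+1\}\big)=\Pr\big(c\text{ is a standard Young tableau of shape }\mu\big)=P(\mu),$$ where $$P(\mu)=\frac{n_0!\cdots n_d!}{\prod_{(i,j)\in\mu}|h_{ij}|}=\prod_{0\le i<j\le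 d}\frac{n_i-n_j+j-i}{n_i+j-i},$$ and $|h_{ij}|$ is the length of the hook through the cell $(i,j)$ of $\mu$: the number of cells of $\mu$ weakly to the right of $(i,j)$ in row $i$ or weakly below $(i,j)$ in column $j$. -/

import Mathlib

open MeasureTheory ProbabilityTheory

namespace YoungFilling

/-- A filling of the Young diagram `μ` by natural numbers: `a i j` is the entry in row `i` and
column `j` (both indexed from `0`), and, as for Mathlib's semistandard Young tableaux, `a` vanishes
outside `μ`, so that it is determined by its entries in the cells of `μ`. -/
def IsFilling (μ : YoungDiagram) (a : ℕ → ℕ → ℕ) : Prop :=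
  ∀ i j, (i, j) ∉ μ → a i j = 0

/-- The entries increase strictly down each column. -/
def ColStrict (μ : YoungDiagram) (a : ℕ → ℕ → ℕ) : Prop :=
  ∀ i₁ i₂ j, i₁ < i₂ → (i₂, j) ∈ μ → a i₁ j < a i₂ j

/-- The entries increase weakly along each row. -/
def RowWeak (μ : YoungDiagram) (a : ℕ → ℕ → ℕ) : Prop :=
  ∀ i j₁ j₂, j₁ < j₂ → (i, j₂) ∈ μ → a i j₁ ≤ a i j₂

/-- The entries increase strictly along each row. -/
def RowStrict (μ : YoungDiagram) (a : ℕ → ℕ → ℕ) : Prop :=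
  ∀ i j₁ j₂, j₁ < j₂ → (i, j₂) ∈ μ → a i j₁ < a i j₂

/-- Each of the numbers `1, …, |μ|` occurs in exactly one cell of `μ`, and nothing else occurs. -/
def UsesEachOnce (μ : YoungDiagram) (a : ℕ → ℕ → ℕ) : Prop :=
  Set.BijOn (fun c : ℕ × ℕ => a c.1 c.2) (μ.cells : Set (ℕ × ℕ)) (Set.Icc 1 μ.card)

/-- Semistandard Young tableaux of shape `μ` with entries in `{1, …, N}`. -/
def ST (N : ℕ) (μ : YoungDiagram) : Set (ℕ → ℕ → ℕ) :=
  {a | (∃ T : SemistandardYoungTableau μ, T.entry = a) ∧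
    ∀ i j, (i, j) ∈ μ → 1 ≤ a i j ∧ a i j ≤ N}

/-- Standard Young tableaux of shape `μ`. -/
def STstar (μ : YoungDiagram) : Set (ℕ → ℕ → ℕ) :=
  {a | IsFilling μ a ∧ UsesEachOnce μ a ∧ RowStrict μ a ∧ ColStrict μ a}

/-- Fillings of `μ` by positive integers with strictly increasing columns, such that the entries in
column `j` are at most `N + j`. -/
def boldSTC (N : ℕ) (μ : YoungDiagram) : Set (ℕ → ℕ → ℕ) :=
  {a | IsFilling μ a ∧ ColStrict μ a ∧ ∀ i j, (i, j) ∈ μ → 1 ≤ a i j ∧ a i j ≤ N + j}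

/-- Fillings of `μ` by positive integers with weakly increasing rows, such that the entries in
row `i` are greater than `i` and at most `N`. -/
def boldSTR (N : ℕ) (μ : YoungDiagram) : Set (ℕ → ℕ → ℕ) :=
  {a | IsFilling μ a ∧ RowWeak μ a ∧ ∀ i j, (i, j) ∈ μ → i < a i j ∧ a i j ≤ N}

/-- Fillings of `μ` with one of each of the numbers `1, …, |μ|`, increasing down each column. -/
def boldSTstar (μ : YoungDiagram) : Set (ℕ → ℕ → ℕ) :=
  {a | IsFilling μ a ∧ UsesEachOnce μ a ∧ ColStrict μ a}

/-- `ST N μ` for `N` the length of the first column of `μ`. -/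
def ST₀ (μ : YoungDiagram) : Set (ℕ → ℕ → ℕ) := ST (μ.colLen 0) μ

/-- `boldSTR N μ` for `N` the length of the first column of `μ`. -/
def boldSTR₀ (μ : YoungDiagram) : Set (ℕ → ℕ → ℕ) := boldSTR (μ.colLen 0) μ

/-- The hook through the cell `(i, j)`: the cells of `μ` that lie weakly to the right of `(i, j)` in
its row, or weakly below it in its column. -/
def hook (μ : YoungDiagram) (c : ℕ × ℕ) : Finset (ℕ × ℕ) :=
  μ.cells.filter fun x => (x.1 = c.1 ∧ c.2 ≤ x.2) ∨ (x.2 = c.2 ∧ c.1 ≤ x.1)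

/-- `P(μ) = n₀! ⋯ n_d! / ∏ |h_{ij}|`, where `n₀, …, n_d` are the column lengths of `μ`. -/
noncomputable def P (μ : YoungDiagram) : ℝ :=
  (∏ j ∈ Finset.range (μ.rowLen 0), ((μ.colLen j).factorial : ℝ)) /
    ∏ c ∈ μ.cells, ((hook μ c).card : ℝ)

/-- The probability that an element of `S`, chosen uniformly at random, lies in `A`. -/
noncomputable def Pr (S A : Set (ℕ → ℕ → ℕ)) : ℝ := (uniformOn S).real A

end YoungFilling

namespace YoungFilling

/-! All three probabilities reduce to one determinant D = det(1/(n_i - i + j)!), with 1/z! = 0 for z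
< 0. Deleting the cells that hold the largest entry gives recursions for the tableau counts. The
determinants obey the same recursions: terms for shapes that are not partitions vanish because two
rows coincide or the last row is zero. Hence there are |μ|! D standard tableaux (`ncard_standard`)
and det binom(N + j, n_i - i + j) semistandard ones (`ncard_semistandard`); pulling factorials out
of rows and columns turns the latter into D ∏ (N + j)!/(N + j - n_j)! (`ncard_ST`).

The large sets are easy to count: ∏ binom(N + j, n_j) by independent columns, |μ|!/∏ n_j! by a
multinomial recursion, and a product of binomials by independent rows of μ'. The first two quotients
are n_0! ⋯ n_d! D at once. For μ', D is unchanged by transposition and the remaining factors are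
regrouped as a product over cells.

Finally D is the reciprocal of the hook product (`prod_hook_mul_detInvFact`): with l_i = n_i + d -
i, the determinant D ∏ l_i! is a Vandermonde in falling factorials, equal to ∏ (l_i - l_j) over i <
j, while the hooks of column i times the differences l_i - l_j, j > i, give l_i!. -/

/-! ### Determinants of reciprocal factorials and of binomials, and their recursions. -/

/-- The reciprocal factorial, extended by zero to the negative integers. -/
noncomputable def invFact (z : ℤ) : ℝ := if z < 0 then 0 else ((z.toNat.factorial : ℕ) : ℝ)⁻¹

lemma invFact_natCast (n : ℕ) : invFact n = ((n.factorial : ℕ) : ℝ)⁻¹ := by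
  simp [invFact]

lemma invFact_of_neg {z : ℤ} (hz : z < 0) : invFact z = 0 := by
  simp [invFact, hz]

/-- The convention 1/(-1)! = 0 covers z = 0, so the identity needs no side condition and determinant
recursions need no case split on signs. -/
lemma mul_invFact (z : ℤ) : (z : ℝ) * invFact z = invFact (z - 1) := by
  rcases lt_trichotomy z 0 with h | rfl | h
  · rw [invFact_of_neg h, invFact_of_neg (by omega), mul_zero]
  · rw [invFact_of_neg (z := 0 - 1) (by omega)]
    simp
  · obtain ⟨n, rfl⟩ : ∃ n : ℕ, z = ((n + 1 : ℕ) : ℤ) := ⟨(z - 1).toNat, by omega⟩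
    have : (((n + 1 : ℕ) : ℤ) - 1) = (n : ℤ) := by push_cast; ring
    rw [this, invFact_natCast, invFact_natCast, Nat.factorial_succ]
    have := Nat.factorial_ne_zero n
    push_cast
    field_simp

/-- The binomial coefficient `N` over `z`, for an arbitrary integer `z`. -/
noncomputable def binom (N : ℕ) (z : ℤ) : ℝ := (N.factorial : ℝ) * (invFact z * invFact (N - z))

lemma binom_succ (N : ℕ) (z : ℤ) : binom (N + 1) z = binom N z + binom N (z - 1) := by
  have h1 := mul_invFact z
  have h2 := mul_invFact (((N + 1 : ℕ) : ℤ) - z)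
  have e1 : ((N + 1 : ℕ) : ℤ) - z - 1 = N - z := by push_cast; ring
  have e2 : (N : ℤ) - (z - 1) = ((N + 1 : ℕ) : ℤ) - z := by push_cast; ring
  rw [e1] at h2
  rw [binom, binom, binom, e2, ← h1, ← h2, Nat.factorial_succ]
  push_cast
  ring

lemma binom_of_neg {N : ℕ} {z : ℤ} (hz : z < 0) : binom N z = 0 := by
  simp [binom, invFact_of_neg hz]

lemma binom_of_lt {N : ℕ} {z : ℤ} (hz : (N : ℤ) < z) : binom N z = 0 := by
  rw [binom, invFact_of_neg (z := N - z) (by omega)]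
  simp

/-- The matrix with entries `f j (m i - i)`. -/
def shiftMat (k : ℕ) (f : ℕ → ℤ → ℝ) (m : ℕ → ℤ) : Matrix (Fin k) (Fin k) ℝ :=
  Matrix.of fun i j => f j (m i - i)

/-- Row i depends only on m i - i, so the hypothesis makes rows i and i + 1 equal. For the last row
it reads m i = -1, and every entry then vanishes. This kills the terms of a recursion whose shape is
not a partition. -/
lemma det_shiftMat_eq_zero {k : ℕ} {f : ℕ → ℤ → ℝ} {m : ℕ → ℤ}
    (hf : ∀ (j : ℕ) (z : ℤ), z + j < 0 → f j z = 0) (hm : m k = 0) {i : ℕ} (hi : i < k)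
    (h : m i + 1 = m (i + 1)) : (shiftMat k f m).det = 0 := by
  rcases Nat.lt_or_ge (i + 1) k with h1 | h1
  · refine Matrix.det_zero_of_row_eq (i := ⟨i, hi⟩) (j := ⟨i + 1, h1⟩) (by simp) ?_
    ext j
    simp only [shiftMat, Matrix.of_apply]
    congr 1
    push_cast
    omega
  · obtain rfl : k = i + 1 := by omega
    refine Matrix.det_eq_zero_of_row_eq_zero ⟨i, hi⟩ fun j => ?_
    simp only [shiftMat, Matrix.of_apply]
    apply hf
    have := j.2
    omega

/-- The determinant of `1 / (m i - i + j)!`. -/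
noncomputable def detInvFact (k : ℕ) (m : ℕ → ℤ) : ℝ :=
  (shiftMat k (fun j z => invFact (z + j)) m).det

/-- The determinant of `binom (N + j) (m i - i + j)`. -/
noncomputable def detBinom (k N : ℕ) (m : ℕ → ℤ) : ℝ :=
  (shiftMat k (fun j z => binom (N + j) (z + j)) m).det

lemma detInvFact_eq_zero {k : ℕ} {m : ℕ → ℤ} (hm : m k = 0) {i : ℕ} (hi : i < k)
    (h : m i + 1 = m (i + 1)) : detInvFact k m = 0 :=
  det_shiftMat_eq_zero (fun _ _ hz => invFact_of_neg hz) hm hi h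

lemma detBinom_eq_zero {k N : ℕ} {m : ℕ → ℤ} (hm : m k = 0) {i : ℕ} (hi : i < k)
    (h : m i + 1 = m (i + 1)) : detBinom k N m = 0 :=
  det_shiftMat_eq_zero (fun _ _ hz => binom_of_neg hz) hm hi h

/-- In binom (N + j) (m i - i + j) the factor (N + j)! depends on the column only and 1/(N - m i +
i)! on the row only. -/
lemma detBinom_eq_mul (k N : ℕ) (m : ℕ → ℤ) :
    detBinom k N m = (∏ j ∈ Finset.range k, ((N + j).factorial : ℝ)) *
      ((∏ i ∈ Finset.range k, invFact (N - m i + i)) * detInvFact k m) := by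
  rw [Finset.prod_range, Finset.prod_range, detInvFact, ← Matrix.det_mul_column,
    ← Matrix.det_mul_row, detBinom]
  congr 1
  ext i j
  simp only [shiftMat, Matrix.of_apply, binom]
  have : (((N + (j : ℕ) : ℕ) : ℤ) - (m i - (i : ℕ) + (j : ℕ))) = N - m i + (i : ℕ) := by
    push_cast; ring
  rw [this]
  ring

/-- In the term of a permutation, reweighting row r contributes u r + v j, where j is the column
matched to r. Summing over r meets every row and every column once, so the total weight is the same
for all permutations. -/
lemma sum_det_updateRow_add_mul {k : ℕ} (M : Matrix (Fin k) (Fin k) ℝ) (u v : Fin k → ℝ) :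
    ∑ r, (M.updateRow r fun j => (u r + v j) * M r j).det = (∑ r, u r + ∑ j, v j) * M.det := by
  simp_rw [Matrix.det_apply]
  rw [Finset.sum_comm, Finset.mul_sum]
  refine Finset.sum_congr rfl fun σ _ => ?_
  rw [← Finset.smul_sum, mul_smul_comm]
  congr 1
  have key : ∀ r, ∏ i, (M.updateRow r fun j => (u r + v j) * M r j) (σ i) i
      = (u r + v (σ.symm r)) * ∏ i, M (σ i) i := by
    intro r
    rw [← Finset.mul_prod_erase _ _ (Finset.mem_univ (σ.symm r)),
      ← Finset.mul_prod_erase Finset.univ (fun i => M (σ i) i) (Finset.mem_univ (σ.symm r))]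
    rw [Equiv.apply_symm_apply, Matrix.updateRow_self, mul_assoc]
    congr 2
    refine Finset.prod_congr rfl fun i hi => ?_
    rw [Matrix.updateRow_ne]
    rintro rfl
    simp at hi
  simp_rw [key]
  rw [← Finset.sum_mul, Finset.sum_add_distrib]
  congr 2
  exact Equiv.sum_comp σ.symm v

lemma sum_detInvFact_sub_one (k : ℕ) (m : ℕ → ℤ) :
    ∑ r ∈ Finset.range k, detInvFact k (Function.update m r (m r - 1)) =
      (∑ r ∈ Finset.range k, (m r : ℝ)) * detInvFact k m := by
  -- The weight (m r - r) + j is the argument of the factorial in entry (r, j), so multiplying by it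
  -- lowers m r by one.
  have h := sum_det_updateRow_add_mul (shiftMat k (fun j z => invFact (z + j)) m)
    (fun r => (m r : ℝ) - (r : ℕ)) (fun j => ((j : ℕ) : ℝ))
  rw [Finset.sum_range, Finset.sum_range, detInvFact]
  have e : ∑ r : Fin k, ((m r : ℝ) - (r : ℕ)) + ∑ j : Fin k, ((j : ℕ) : ℝ)
      = ∑ r : Fin k, (m r : ℝ) := by
    rw [Finset.sum_sub_distrib]; ring
  rw [e] at h
  rw [← h]
  refine Finset.sum_congr rfl fun r _ => ?_
  rw [detInvFact]
  congr 1
  ext i j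
  rcases eq_or_ne i r with rfl | hir
  · rw [Matrix.updateRow_self]
    simp only [shiftMat, Matrix.of_apply, Function.update_self]
    have := mul_invFact (m i - (i : ℕ) + (j : ℕ))
    push_cast at this
    rw [this]
    congr 1
    ring
  · rw [Matrix.updateRow_ne hir]
    have : (i : ℕ) ≠ r := fun h => hir (Fin.ext h)
    simp [shiftMat, Function.update_of_ne this]

/-- Pascal's rule writes each row as a sum of two rows; E records the rows where the lowered term is
chosen in the multilinear expansion. -/
lemma detBinom_succ (k N : ℕ) (m : ℕ → ℤ) :
    detBinom k (N + 1) m = ∑ E : Finset (Fin k),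
      detBinom k N fun j => m j - if j ∈ E.map Fin.valEmbedding then 1 else 0 := by
  set A : Fin k → Fin k → ℝ := fun i j => binom (N + j) (m i - 1 - (i : ℕ) + (j : ℕ)) with hA
  set B : Fin k → Fin k → ℝ := fun i j => binom (N + j) (m i - (i : ℕ) + (j : ℕ)) with hB
  have h : detBinom k (N + 1) m = Matrix.detRowAlternating.toMultilinearMap (A + B) := by
    change Matrix.det _ = Matrix.det _
    congr 1
    ext i j
    simp only [shiftMat, Matrix.of_apply, Pi.add_apply, hA, hB]
    rw [add_right_comm N 1, binom_succ, add_comm]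
    congr 2
    ring
  rw [h, MultilinearMap.map_add_univ]
  refine Finset.sum_congr rfl fun E _ => ?_
  change Matrix.det _ = Matrix.det _
  congr 1
  ext i j
  have hmem : ((i : ℕ) ∈ E.map Fin.valEmbedding) ↔ i ∈ E := Finset.mem_map' Fin.valEmbedding
  by_cases hi : i ∈ E
  · simp [-Finset.mem_map, shiftMat, hA, hi, hmem]
  · simp [-Finset.mem_map, shiftMat, hB, hi, hmem]

lemma detBinom_zero_of_eq_zero (k : ℕ) {m : ℕ → ℤ} (hm : ∀ j, m j = 0) : detBinom k 0 m = 1 := by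
  rw [detBinom, Matrix.det_of_isUpperTriangular]
  · refine Finset.prod_eq_one fun i _ => ?_
    simp only [shiftMat, Matrix.of_apply, hm]
    have : (0 : ℤ) - (i : ℕ) + (i : ℕ) = ((0 : ℕ) : ℤ) := by simp
    rw [this, binom, sub_eq_add_neg, Nat.cast_zero, neg_zero, add_zero, zero_add,
      invFact_natCast]
    have := Nat.factorial_ne_zero (i : ℕ)
    have h0 : invFact 0 = 1 := by simp [invFact]
    rw [h0]
    field_simp
  · intro i j hij
    simp only [shiftMat, Matrix.of_apply, hm]
    apply binom_of_neg
    have : (j : ℕ) < i := hij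
    omega

lemma detBinom_zero_of_pos {k : ℕ} (hk : 0 < k) {m : ℕ → ℤ} (hm : 0 < m 0) :
    detBinom k 0 m = 0 := by
  refine Matrix.det_eq_zero_of_row_eq_zero ⟨0, hk⟩ fun j => ?_
  simp only [shiftMat, Matrix.of_apply]
  apply binom_of_lt
  push_cast
  omega


/-! ### Counting a set by splitting it according to a unique label. -/

lemma ncard_eq_sum_of_bijOn {α β ι : Type*} {S : Set α} {T : Finset ι} (p : ι → α → Prop)
    (hcover : ∀ a ∈ S, ∃ e ∈ T, p e a)
    (huniq : ∀ a ∈ S, ∀ e ∈ T, ∀ e' ∈ T, p e a → p e' a → e = e')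
    {R : ι → Set β} (φ : ι → α → β) (hφ : ∀ e ∈ T, Set.BijOn (φ e) {a | a ∈ S ∧ p e a} (R e))
    (hfin : ∀ e ∈ T, (R e).Finite) :
    S.Finite ∧ S.ncard = ∑ e ∈ T, (R e).ncard := by
  classical
  have hS : S = ⋃ e ∈ T, {a | a ∈ S ∧ p e a} := by
    ext a
    simp only [Set.mem_iUnion, Set.mem_ofPred_eq, exists_prop]
    exact ⟨fun h => (hcover a h).imp fun e he => ⟨he.1, h, he.2⟩, fun ⟨_, _, h, _⟩ => h⟩
  have hf : ∀ e ∈ T, {a | a ∈ S ∧ p e a}.Finite := fun e he =>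
    Set.Finite.of_finite_image ((hφ e he).image_eq ▸ hfin e he) (hφ e he).injOn
  have hSf : S.Finite := by
    rw [hS]
    exact T.finite_toSet.biUnion hf
  refine ⟨hSf, ?_⟩
  have hcard : ∀ e ∈ T, (R e).ncard = {a | a ∈ S ∧ p e a}.ncard := fun e he => by
    rw [← (hφ e he).image_eq, (hφ e he).injOn.ncard_image]
  rw [Finset.sum_congr rfl hcard, Set.ncard_eq_toFinset_card S hSf]
  have hb : hSf.toFinset = T.biUnion fun e => hSf.toFinset.filter (p e) := by
    ext a
    simp only [Set.Finite.mem_toFinset, Finset.mem_biUnion, Finset.mem_filter]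
    exact ⟨fun h => (hcover a h).imp fun e he => ⟨he.1, h, he.2⟩, fun ⟨_, _, h, _⟩ => h⟩
  rw [hb, Finset.card_biUnion]
  · refine Finset.sum_congr rfl fun e _ => ?_
    rw [← Set.ncard_coe_finset]
    congr 1
    ext a
    simp
  · intro e he e' he' hne
    rw [Function.onFun, Finset.disjoint_left]
    intro a ha ha'
    simp only [Finset.mem_filter, Set.Finite.mem_toFinset] at ha ha'
    exact hne (huniq a ha.1 e he e' he' ha.2 ha'.2)

/-! ### Semistandard tableaux: removing the horizontal strip of largest entries. -/

/-- Semistandard fillings with entries in `{1, …, N}` of the shape with column lengths `n`. -/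
def semistandard (N : ℕ) (n : ℕ → ℕ) : Set (ℕ → ℕ → ℕ) :=
  {a | (∀ i j, n j ≤ i → a i j = 0) ∧ (∀ i j₁ j₂, j₁ < j₂ → i < n j₂ → a i j₁ ≤ a i j₂) ∧
    (∀ i₁ i₂ j, i₁ < i₂ → i₂ < n j → a i₁ j < a i₂ j) ∧ ∀ i j, i < n j → 1 ≤ a i j ∧ a i j ≤ N}

/-- Remove the bottom cells of the columns in `E`. -/
def removeStrip (n : ℕ → ℕ) (E : Finset ℕ) (j : ℕ) : ℕ := n j - if j ∈ E then 1 else 0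

/-- Set the bottom entries of the columns in `E` to `v`. -/
def setBottom (n : ℕ → ℕ) (E : Finset ℕ) (v : ℕ) (a : ℕ → ℕ → ℕ) (i j : ℕ) : ℕ :=
  if j ∈ E ∧ i + 1 = n j then v else a i j

lemma lt_removeStrip_iff {n : ℕ → ℕ} {E : Finset ℕ} (hE : ∀ j ∈ E, 0 < n j) (i j : ℕ) :
    i < removeStrip n E j ↔ i < n j ∧ ¬ (j ∈ E ∧ i + 1 = n j) := by
  unfold removeStrip
  split_ifs with h
  · have := hE j h
    simp only [h, true_and]
    omega
  · simp [h]

/-- Strict columns allow N + 1 only at the bottom of a column, so erasing it from the columns in E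
leaves entries at most N. Writing N + 1 back is the inverse. -/
lemma semistandard_bijOn {N : ℕ} {n : ℕ → ℕ} (hn : Antitone n) {E : Finset ℕ}
    (hE : ∀ j ∈ E, 0 < n j) (hanti : Antitone (removeStrip n E)) :
    Set.BijOn (setBottom n E 0)
      {a | a ∈ semistandard (N + 1) n ∧ ∀ j, j ∈ E ↔ 0 < n j ∧ a (n j - 1) j = N + 1}
      (semistandard N (removeStrip n E)) := by
  have hlt := lt_removeStrip_iff hE
  have hle : ∀ j₁ j₂, j₁ < j₂ → removeStrip n E j₂ ≤ removeStrip n E j₁ := fun _ _ h => hanti h.le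
  refine Set.InvOn.bijOn (f' := setBottom n E (N + 1)) ⟨?_, ?_⟩ ?_ ?_
  · rintro a ⟨-, ha⟩
    ext i j
    simp only [setBottom]
    split_ifs with h
    · have := ((ha j).1 h.1).2
      rw [← this]
      congr 1
      omega
    · rfl
  · rintro b ⟨hz, -⟩
    ext i j
    simp only [setBottom]
    split_ifs with h
    · refine (hz i j ?_).symm
      by_contra hc
      exact ((hlt i j).1 (not_le.1 hc)).2 h
    · rfl
  · rintro a ⟨⟨hz, hr, hc, hb⟩, ha⟩
    refine ⟨fun i j hij => ?_, fun i j₁ j₂ hj hi => ?_, fun i₁ i₂ j hi hi₂ => ?_,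
      fun i j hi => ?_⟩
    · simp only [setBottom]
      split_ifs with h
      · rfl
      · refine hz i j (not_lt.1 fun hc => ?_)
        exact absurd ((hlt i j).2 ⟨hc, h⟩) (not_lt.2 hij)
    · have h1 := (hlt _ _).1 (hi.trans_le (hle _ _ hj))
      have h2 := (hlt _ _).1 hi
      simp only [setBottom, h1.2, h2.2, if_false]
      exact hr i j₁ j₂ hj h2.1
    · have h1 := (hlt _ _).1 (hi.trans hi₂)
      have h2 := (hlt _ _).1 hi₂
      simp only [setBottom, h1.2, h2.2, if_false]
      exact hc i₁ i₂ j hi h2.1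
    · have h1 := (hlt _ _).1 hi
      simp only [setBottom, h1.2, if_false]
      refine ⟨(hb i j h1.1).1, ?_⟩
      have hlast := hb (n j - 1) j (by omega)
      by_cases hj : j ∈ E
      · have := hc i (n j - 1) j (by have := h1.2; simp only [hj, true_and] at this; omega)
          (by omega)
        omega
      · have hne : a (n j - 1) j ≠ N + 1 := fun h => hj ((ha j).2 ⟨by omega, h⟩)
        rcases Nat.lt_or_ge i (n j - 1) with h | h
        · have := hc i (n j - 1) j h (by omega)
          omega
        · obtain rfl : i = n j - 1 := by omega
          omega
  · rintro b ⟨hz, hr, hc, hb⟩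
    refine ⟨⟨fun i j hij => ?_, fun i j₁ j₂ hj hi => ?_, fun i₁ i₂ j hi hi₂ => ?_,
      fun i j hi => ?_⟩, fun j => ⟨fun hj => ?_, fun hj => ?_⟩⟩
    · simp only [setBottom]
      rw [if_neg (by omega)]
      exact hz i j (not_lt.1 fun hc => by have := ((hlt i j).1 hc).1; omega)
    · by_cases h2 : j₂ ∈ E ∧ i + 1 = n j₂
      · simp only [setBottom, h2, and_self, if_true]
        split_ifs with h1
        · exact le_rfl
        · have hi1 : i < n j₁ := hi.trans_le (hn hj.le)
          have := hb i j₁ ((hlt _ _).2 ⟨hi1, fun h => h1 ⟨h.1, by omega⟩⟩)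
          omega
      · have h := (hlt i j₂).2 ⟨hi, h2⟩
        have h1 := ((hlt i j₁).1 (h.trans_le (hle _ _ hj))).2
        simp only [setBottom, h1, h2, if_false]
        exact hr i j₁ j₂ hj h
    · have h1 : ¬ (j ∈ E ∧ i₁ + 1 = n j) := by omega
      simp only [setBottom, h1, if_false]
      split_ifs with h2
      · have := hb i₁ j ((hlt _ _).2 ⟨by omega, h1⟩)
        omega
      · exact hc i₁ i₂ j hi ((hlt _ _).2 ⟨hi₂, h2⟩)
    · simp only [setBottom]
      split_ifs with h
      · omega
      · have := hb i j ((hlt _ _).2 ⟨hi, h⟩)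
        omega
    · have := hE j hj
      refine ⟨this, ?_⟩
      simp only [setBottom]
      rw [if_pos ⟨hj, by omega⟩]
    · by_contra hE'
      have h := hj.2
      simp only [setBottom, hE', false_and, if_false] at h
      have := hb (n j - 1) j ((hlt _ _).2 ⟨by omega, fun h => hE' h.1⟩)
      omega

/-- Failure would need columns j and j + 1 of equal length with only column j losing its bottom
cell; but weak rows force the bottom entry of column j + 1 to be N + 1 too. -/
lemma antitone_removeStrip {N : ℕ} {n : ℕ → ℕ} (hn : Antitone n) {E : Finset ℕ}
    {a : ℕ → ℕ → ℕ} (ha : a ∈ semistandard (N + 1) n)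
    (hE : ∀ j, j ∈ E ↔ 0 < n j ∧ a (n j - 1) j = N + 1) : Antitone (removeStrip n E) := by
  obtain ⟨hz, hr, hc, hb⟩ := ha
  refine antitone_nat_of_succ_le fun j => ?_
  have h0 := hn (Nat.le_succ j)
  simp only [Nat.succ_eq_add_one] at h0
  by_contra! hlt
  have h1 : j ∈ E := by
    by_contra h
    simp only [removeStrip, h, if_false] at hlt
    omega
  have h2 : j + 1 ∉ E := by
    intro h
    simp only [removeStrip, h, h1, if_true] at hlt
    omega
  simp only [removeStrip, h1, h2, if_true, if_false] at hlt
  obtain ⟨h3, h4⟩ := (hE j).1 h1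
  have h5 : n (j + 1) = n j := by omega
  refine h2 ((hE (j + 1)).2 ⟨by omega, ?_⟩)
  have h6 := hr (n j - 1) j (j + 1) (by omega) (by omega)
  have h7 := hb (n j - 1) (j + 1) (by omega)
  rw [h5]
  omega

/-- If E is not removable, the lowered lengths are not antitone: antitone and eventually zero would
make them nonnegative. They therefore rise somewhere, and by exactly one since each length drops by
at most one; the determinant then vanishes. -/
lemma detBinom_removeStrip_eq_zero {k N : ℕ} {n : ℕ → ℕ} (hn : Antitone n)
    (hk : ∀ j, k ≤ j → n j = 0) {E : Finset ℕ} (hEk : ∀ j ∈ E, j < k)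
    (h : ¬ ((∀ j ∈ E, 0 < n j) ∧ Antitone (removeStrip n E))) :
    detBinom k N (fun j => (n j : ℤ) - if j ∈ E then 1 else 0) = 0 := by
  set m : ℕ → ℤ := fun j => (n j : ℤ) - if j ∈ E then 1 else 0 with hm
  have hmk : ∀ j, k ≤ j → m j = 0 := by
    intro j hj
    have : j ∉ E := fun h => absurd (hEk j h) (by omega)
    simp [hm, hk j hj, this]
  by_cases hanti : Antitone m
  · exfalso
    apply h
    have hnn : ∀ j, 0 ≤ m j := fun j => by
      rw [← hmk (max j k) (le_max_right _ _)]
      exact hanti (le_max_left _ _)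
    refine ⟨fun j hj => ?_, fun i j hij => ?_⟩
    · have := hnn j
      simp only [hm, hj, if_true] at this
      omega
    · have h1 := hanti hij
      have h2 := hnn i
      have h3 := hnn j
      simp only [hm] at h1 h2 h3
      simp only [removeStrip]
      split_ifs at * <;> omega
  · obtain ⟨i, hi⟩ : ∃ i, m i < m (i + 1) := by
      by_contra! hc
      exact hanti (antitone_nat_of_succ_le hc)
    have hik : i < k := by
      by_contra hc
      rw [hmk i (by omega), hmk (i + 1) (by omega)] at hi
      exact lt_irrefl _ hi
    refine detBinom_eq_zero (hmk k le_rfl) hik ?_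
    have h0 := hn (Nat.le_succ i)
    simp only [Nat.succ_eq_add_one] at h0
    simp only [hm] at hi ⊢
    split_ifs at * <;> omega

theorem ncard_semistandard {k : ℕ} (N : ℕ) {n : ℕ → ℕ} (hn : Antitone n)
    (hk : ∀ j, k ≤ j → n j = 0) :
    (semistandard N n).Finite ∧ ((semistandard N n).ncard : ℝ) = detBinom k N fun j => n j := by
  classical
  induction N generalizing n with
  | zero =>
    rcases Nat.eq_zero_or_pos (n 0) with h0 | h0
    · have hn0 : ∀ j, n j = 0 := fun j => Nat.le_zero.1 (h0 ▸ hn (Nat.zero_le j))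
      have : semistandard 0 n = {fun _ _ => 0} := by
        ext a
        simp only [semistandard, Set.mem_ofPred_eq, hn0, Set.mem_singleton_iff]
        constructor
        · intro h
          ext i j
          exact h.1 i j (Nat.zero_le _)
        · rintro rfl
          simp
      rw [this, detBinom_zero_of_eq_zero k (by simp [hn0])]
      simp
    · have : semistandard 0 n = ∅ := by
        ext a
        simp only [semistandard, Set.mem_ofPred_eq, Set.mem_empty_iff_false, iff_false]
        rintro ⟨-, -, -, h⟩
        have := h 0 0 h0
        omega
      have hk0 : 0 < k := by
        by_contra h
        have := hk 0 (by omega)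
        omega
      rw [this, detBinom_zero_of_pos hk0 (by exact_mod_cast h0)]
      simp
  | succ N ih =>
    -- The label of a tableau is its set of columns ending in N + 1. Subsets of `Fin k` match the
    -- index set of `detBinom_succ`, and `ok` keeps those whose removal leaves a partition.
    let v : Finset (Fin k) → Finset ℕ := fun E => E.map Fin.valEmbedding
    let ok : Finset (Fin k) → Prop := fun E =>
      (∀ j ∈ v E, 0 < n j) ∧ Antitone (removeStrip n (v E))
    have hvk : ∀ E, ∀ j ∈ v E, j < k := by
      intro E j hj
      obtain ⟨x, -, rfl⟩ := Finset.mem_map.1 hj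
      exact x.2
    have hrk : ∀ E j, k ≤ j → removeStrip n E j = 0 := by
      intro E j hj
      simp [removeStrip, hk j hj]
    have key := ncard_eq_sum_of_bijOn (S := semistandard (N + 1) n) (T := Finset.univ.filter ok)
      (fun E a => ∀ j, j ∈ v E ↔ 0 < n j ∧ a (n j - 1) j = N + 1) ?_ ?_
      (R := fun E => semistandard N (removeStrip n (v E))) (fun E => setBottom n (v E) 0) ?_ ?_
    · refine ⟨key.1, ?_⟩
      rw [key.2, detBinom_succ]
      push_cast
      rw [Finset.sum_filter]
      refine Finset.sum_congr rfl fun E _ => ?_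
      split_ifs with h
      · rw [(ih h.2 (hrk _)).2]
        congr 1
        ext j
        by_cases hj : j ∈ v E
        · have h1 := h.1 j hj
          have h2 : removeStrip n (v E) j = n j - 1 := by simp only [removeStrip, hj, if_true]
          have h3 : (if j ∈ Finset.map Fin.valEmbedding E then (1 : ℤ) else 0) = 1 := if_pos hj
          rw [h2, h3]
          omega
        · have h2 : removeStrip n (v E) j = n j := by simp [removeStrip, hj]
          have h3 : (if j ∈ Finset.map Fin.valEmbedding E then (1 : ℤ) else 0) = 0 := if_neg hj
          rw [h2, h3]
          simp
      · exact (detBinom_removeStrip_eq_zero hn hk (hvk E) h).symm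
    · intro a ha
      have hmem : ∀ j, j ∈ v (Finset.univ.filter fun j : Fin k =>
          0 < n j ∧ a (n j - 1) j = N + 1) ↔ 0 < n j ∧ a (n j - 1) j = N + 1 := by
        intro j
        simp only [v, Finset.mem_map, Finset.mem_filter, Finset.mem_univ, true_and]
        constructor
        · rintro ⟨x, hx, rfl⟩
          exact hx
        · intro h
          have hj : j < k := by
            by_contra hc
            have := hk j (by omega)
            omega
          exact ⟨⟨j, hj⟩, h, rfl⟩
      refine ⟨_, Finset.mem_filter.2 ⟨Finset.mem_univ _, fun j hj => ((hmem j).1 hj).1, ?_⟩, hmem⟩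
      exact antitone_removeStrip hn ha hmem
    · intro a _ E _ E' _ h h'
      apply Finset.map_injective Fin.valEmbedding
      ext j
      exact (h j).trans (h' j).symm
    · intro E hE
      have h := (Finset.mem_filter.1 hE).2
      exact semistandard_bijOn hn h.1 h.2
    · intro E hE
      exact (ih (Finset.mem_filter.1 hE).2.2 (hrk _)).1


/-! ### Column-increasing and standard fillings: removing the cell of the largest number. -/

/-- Fillings with one of each of the numbers `1, …, t` and increasing columns, of the shape with
column lengths `n`. -/
def colStandard (t : ℕ) (n : ℕ → ℕ) : Set (ℕ → ℕ → ℕ) :=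
  {a | (∀ i j, n j ≤ i → a i j = 0) ∧
    Set.BijOn (fun c : ℕ × ℕ => a c.1 c.2) {c | c.1 < n c.2} (Set.Icc 1 t) ∧
    ∀ i₁ i₂ j, i₁ < i₂ → i₂ < n j → a i₁ j < a i₂ j}

/-- The elements of `colStandard t n` with increasing rows. -/
def standard (t : ℕ) (n : ℕ → ℕ) : Set (ℕ → ℕ → ℕ) :=
  {a | a ∈ colStandard t n ∧ ∀ i j₁ j₂, j₁ < j₂ → i < n j₂ → a i j₁ < a i j₂}

lemma cells_removeStrip {n : ℕ → ℕ} {i : ℕ} (hi : 0 < n i) :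
    {c : ℕ × ℕ | c.1 < n c.2} =
      insert (n i - 1, i) {c : ℕ × ℕ | c.1 < removeStrip n {i} c.2} := by
  have hlt := lt_removeStrip_iff (n := n) (E := {i}) (by simpa using hi)
  ext ⟨r, j⟩
  simp only [Set.mem_insert_iff, Set.mem_ofPred_eq, hlt, Finset.mem_singleton, Prod.mk.injEq]
  constructor
  · intro h
    by_cases hc : j = i ∧ r + 1 = n j
    · left
      obtain ⟨rfl, h2⟩ := hc
      omega
    · exact Or.inr ⟨h, hc⟩
  · rintro (⟨rfl, rfl⟩ | h)
    · omega
    · exact h.1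

lemma notMem_cells_removeStrip (n : ℕ → ℕ) (i : ℕ) :
    (n i - 1, i) ∉ {c : ℕ × ℕ | c.1 < removeStrip n {i} c.2} := by
  simp [removeStrip]

lemma setBottom_of_lt {n : ℕ → ℕ} {i : ℕ} (hi : 0 < n i) (v : ℕ) (a : ℕ → ℕ → ℕ) {r j : ℕ}
    (h : r < removeStrip n {i} j) : setBottom n {i} v a r j = a r j := by
  have hlt := lt_removeStrip_iff (n := n) (E := {i}) (by simpa using hi)
  simp only [setBottom, ((hlt r j).1 h).2, if_false]

lemma setBottom_bottom {n : ℕ → ℕ} {i : ℕ} (hi : 0 < n i) (v : ℕ) (a : ℕ → ℕ → ℕ) :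
    setBottom n {i} v a (n i - 1) i = v := by
  simp only [setBottom, Finset.mem_singleton, true_and]
  rw [if_pos (by omega)]

lemma Icc_one_succ (t : ℕ) : Set.Icc 1 (t + 1) = insert (t + 1) (Set.Icc 1 t) := by
  ext x
  simp only [Set.mem_Icc, Set.mem_insert_iff]
  omega

/-- With rows unconstrained, the column lengths need not form a partition, so any nonempty column
may lose its bottom cell. -/
lemma colStandard_bijOn {t : ℕ} {n : ℕ → ℕ} {i : ℕ} (hi : 0 < n i) :
    Set.BijOn (setBottom n {i} 0)
      {a | a ∈ colStandard (t + 1) n ∧ a (n i - 1) i = t + 1}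
      (colStandard t (removeStrip n {i})) := by
  have hlt := lt_removeStrip_iff (n := n) (E := {i}) (by simpa using hi)
  refine Set.InvOn.bijOn (f' := setBottom n {i} (t + 1)) ⟨?_, ?_⟩ ?_ ?_
  · rintro a ⟨-, ha⟩
    ext r j
    simp only [setBottom, Finset.mem_singleton]
    split_ifs with h
    · obtain ⟨rfl, h⟩ := h
      rw [← ha]
      congr 1
      omega
    · rfl
  · rintro b ⟨hz, -⟩
    ext r j
    simp only [setBottom]
    split_ifs with h
    · refine (hz r j ?_).symm
      by_contra hc
      exact ((hlt r j).1 (not_le.1 hc)).2 h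
    · rfl
  · rintro a ⟨⟨hz, hb, hc⟩, ha⟩
    refine ⟨fun r j hij => ?_, ?_, fun i₁ i₂ j hi₁ hi₂ => ?_⟩
    · simp only [setBottom]
      split_ifs with h
      · rfl
      · refine hz r j (not_lt.1 fun hc => ?_)
        exact absurd ((hlt r j).2 ⟨hc, h⟩) (not_lt.2 hij)
    · have h1 : Set.BijOn (fun c : ℕ × ℕ => a c.1 c.2)
          {c : ℕ × ℕ | c.1 < removeStrip n {i} c.2} (Set.Icc 1 t) := by
        have h2 := hb
        rw [cells_removeStrip hi, Icc_one_succ] at h2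
        have := (Set.BijOn.insert_iff (f := fun c : ℕ × ℕ => a c.1 c.2) (t := Set.Icc 1 t)
          (notMem_cells_removeStrip n i)
          (by simp only [ha, Set.mem_Icc]; omega)).1 (by simpa only [ha] using h2)
        exact this
      refine h1.congr fun c hc => ?_
      exact (setBottom_of_lt hi 0 a hc).symm
    · rw [setBottom_of_lt hi 0 a hi₂, setBottom_of_lt hi 0 a (hi₁.trans hi₂)]
      exact hc i₁ i₂ j hi₁ ((hlt _ _).1 hi₂).1
  · rintro b ⟨hz, hb, hc⟩
    refine ⟨⟨fun r j hij => ?_, ?_, fun i₁ i₂ j hi₁ hi₂ => ?_⟩, setBottom_bottom hi _ _⟩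
    · simp only [setBottom]
      rw [if_neg (by omega)]
      exact hz r j (not_lt.1 fun hc => by have := ((hlt r j).1 hc).1; omega)
    · rw [cells_removeStrip hi, Icc_one_succ]
      have h1 : Set.BijOn (fun c : ℕ × ℕ => setBottom n {i} (t + 1) b c.1 c.2)
          {c : ℕ × ℕ | c.1 < removeStrip n {i} c.2} (Set.Icc 1 t) :=
        hb.congr fun c hc => (setBottom_of_lt hi _ b hc).symm
      have h2 := setBottom_bottom hi (t + 1) b
      have := (Set.BijOn.insert_iff (f := fun c : ℕ × ℕ => setBottom n {i} (t + 1) b c.1 c.2)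
        (notMem_cells_removeStrip n i) (t := Set.Icc 1 t)
        (by simp only [h2, Set.mem_Icc]; omega)).2 h1
      simpa only [h2] using this
    · have h1 : ¬ (j ∈ ({i} : Finset ℕ) ∧ i₁ + 1 = n j) := by omega
      have h1' := (hlt i₁ j).2 ⟨by omega, h1⟩
      by_cases h2 : j ∈ ({i} : Finset ℕ) ∧ i₂ + 1 = n j
      · have := (hb.mapsTo (show ((i₁, j) : ℕ × ℕ) ∈ {c : ℕ × ℕ | c.1 < removeStrip n {i} c.2}
          from h1')).2
        simp only at this
        rw [setBottom_of_lt hi _ _ h1']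
        simp only [setBottom]
        rw [if_pos h2]
        omega
      · simp only [setBottom, h1, h2, if_false]
        exact hc i₁ i₂ j hi₁ ((hlt _ _).2 ⟨hi₂, h2⟩)

lemma standard_bijOn {t : ℕ} {n : ℕ → ℕ} (hn : Antitone n) {i : ℕ} (hi : 0 < n i)
    (hanti : Antitone (removeStrip n {i})) :
    Set.BijOn (setBottom n {i} 0)
      {a | a ∈ standard (t + 1) n ∧ a (n i - 1) i = t + 1}
      (standard t (removeStrip n {i})) := by
  have hB := colStandard_bijOn (t := t) hi
  have hlt := lt_removeStrip_iff (n := n) (E := {i}) (by simpa using hi)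
  refine ⟨?_, fun a ha b hb h => hB.injOn ⟨ha.1.1, ha.2⟩ ⟨hb.1.1, hb.2⟩ h, ?_⟩
  · rintro a ⟨⟨ha, hr⟩, hv⟩
    refine ⟨hB.mapsTo ⟨ha, hv⟩, fun r j₁ j₂ hj h => ?_⟩
    rw [setBottom_of_lt hi _ _ h, setBottom_of_lt hi _ _ (h.trans_le (hanti hj.le))]
    exact hr r j₁ j₂ hj ((hlt _ _).1 h).1
  · rintro b ⟨hb, hr⟩
    obtain ⟨a, ⟨ha, hv⟩, rfl⟩ := hB.surjOn hb
    refine ⟨a, ⟨⟨ha, fun r j₁ j₂ hj h => ?_⟩, hv⟩, rfl⟩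
    by_cases h2 : j₂ ∈ ({i} : Finset ℕ) ∧ r + 1 = n j₂
    · obtain ⟨h3, h4⟩ := h2
      obtain rfl := Finset.mem_singleton.1 h3
      have hv' : a r j₂ = t + 1 := by
        rw [← hv]
        congr 1
        omega
      have hm1 : ((r, j₁) : ℕ × ℕ) ∈ {c : ℕ × ℕ | c.1 < n c.2} := h.trans_le (hn hj.le)
      have hm2 : ((r, j₂) : ℕ × ℕ) ∈ {c : ℕ × ℕ | c.1 < n c.2} := h
      have hle := (ha.2.1.mapsTo hm1).2
      -- The entry t + 1 is maximal, so only equality must be excluded, and no number occurs twice.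
      have hne : a r j₁ ≠ a r j₂ := fun he => by
        have := ha.2.1.injOn hm1 hm2 he
        simp only [Prod.mk.injEq] at this
        omega
      simp only at hle
      omega
    · have h3 := (hlt _ _).2 ⟨h, h2⟩
      have := hr r j₁ j₂ hj h3
      rwa [setBottom_of_lt hi _ _ h3, setBottom_of_lt hi _ _ (h3.trans_le (hanti hj.le))] at this

lemma exists_bottom_eq {t : ℕ} {n : ℕ → ℕ} {a : ℕ → ℕ → ℕ} (ha : a ∈ colStandard (t + 1) n) :
    ∃ i, 0 < n i ∧ a (n i - 1) i = t + 1 := by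
  obtain ⟨hz, hb, hc⟩ := ha
  obtain ⟨⟨r, i⟩, hr, hv⟩ := hb.surjOn (show t + 1 ∈ Set.Icc 1 (t + 1) from ⟨by omega, le_rfl⟩)
  simp only [Set.mem_ofPred_eq] at hr hv
  refine ⟨i, by omega, ?_⟩
  rcases Nat.lt_or_ge r (n i - 1) with h | h
  · have h1 := hc r (n i - 1) i h (by omega)
    have h2 := (hb.mapsTo (show ((n i - 1, i) : ℕ × ℕ) ∈ {c : ℕ × ℕ | c.1 < n c.2} from
      (by simp only [Set.mem_ofPred_eq]; omega))).2
    simp only at h2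
    omega
  · rw [← hv]
    congr 1
    omega

lemma bottom_unique {t : ℕ} {n : ℕ → ℕ} {a : ℕ → ℕ → ℕ} (ha : a ∈ colStandard (t + 1) n) {i i' : ℕ}
    (hi : 0 < n i) (hi' : 0 < n i') (h : a (n i - 1) i = t + 1) (h' : a (n i' - 1) i' = t + 1) :
    i = i' := by
  have := ha.2.1.injOn (x₁ := (n i - 1, i)) (x₂ := (n i' - 1, i'))
    (by simp only [Set.mem_ofPred_eq]; omega) (by simp only [Set.mem_ofPred_eq]; omega)
    (h.trans h'.symm)
  exact (Prod.mk.inj this).2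

lemma colStandard_zero {k : ℕ} {n : ℕ → ℕ} (hk : ∀ j, k ≤ j → n j = 0)
    (ht : ∑ j ∈ Finset.range k, n j = 0) :
    (∀ j, n j = 0) ∧ colStandard 0 n = {fun _ _ => 0} := by
  have hn0 : ∀ j, n j = 0 := fun j => by
    rcases Nat.lt_or_ge j k with h | h
    · exact Finset.sum_eq_zero_iff.1 ht j (Finset.mem_range.2 h)
    · exact hk j h
  refine ⟨hn0, ?_⟩
  ext a
  simp only [colStandard, Set.mem_ofPred_eq, hn0, Set.mem_singleton_iff]
  constructor
  · intro h
    ext i j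
    exact h.1 i j (Nat.zero_le _)
  · rintro rfl
    simp

lemma removeStrip_singleton (n : ℕ → ℕ) (i : ℕ) :
    removeStrip n {i} = Function.update n i (n i - 1) := by
  ext j
  rcases eq_or_ne j i with rfl | h
  · simp [removeStrip]
  · simp [removeStrip, h]

lemma sum_removeStrip {k t : ℕ} {n : ℕ → ℕ} (ht : ∑ j ∈ Finset.range k, n j = t + 1) {i : ℕ}
    (hik : i < k) (hi : 0 < n i) : ∑ j ∈ Finset.range k, removeStrip n {i} j = t := by
  have hm := Finset.mem_range.2 hik
  rw [removeStrip_singleton, Finset.sum_update_of_mem hm]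
  rw [← Finset.add_sum_erase _ _ hm, ← Finset.sdiff_singleton_eq_erase] at ht
  omega

lemma prod_factorial_removeStrip {k : ℕ} {n : ℕ → ℕ} {i : ℕ} (hik : i < k) (hi : 0 < n i) :
    (∏ j ∈ Finset.range k, (removeStrip n {i} j).factorial) * n i =
      ∏ j ∈ Finset.range k, (n j).factorial := by
  have hm := Finset.mem_range.2 hik
  rw [← Finset.mul_prod_erase _ _ hm, ← Finset.mul_prod_erase _ (fun j => (n j).factorial) hm,
    removeStrip_singleton, Function.update_self, mul_right_comm, mul_comm (Nat.factorial _),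
    Nat.mul_factorial_pred hi.ne']
  congr 1
  refine Finset.prod_congr rfl fun j hj => ?_
  rw [Function.update_of_ne (Finset.ne_of_mem_erase hj)]

theorem ncard_colStandard {k : ℕ} (t : ℕ) {n : ℕ → ℕ} (hk : ∀ j, k ≤ j → n j = 0)
    (ht : ∑ j ∈ Finset.range k, n j = t) :
    (colStandard t n).Finite ∧
      (colStandard t n).ncard * ∏ j ∈ Finset.range k, (n j).factorial = t.factorial := by
  induction t generalizing n with
  | zero =>
    obtain ⟨hn0, h⟩ := colStandard_zero hk ht
    rw [h]
    simp [hn0]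
  | succ t ih =>
    have hrk : ∀ i j, k ≤ j → removeStrip n {i} j = 0 := by
      intro i j hj
      simp [removeStrip, hk j hj]
    have key := ncard_eq_sum_of_bijOn (S := colStandard (t + 1) n)
      (T := (Finset.range k).filter fun i => 0 < n i) (fun i a => a (n i - 1) i = t + 1) ?_ ?_
      (R := fun i => colStandard t (removeStrip n {i})) (fun i => setBottom n {i} 0) ?_ ?_
    · refine ⟨key.1, ?_⟩
      -- Expanding t + 1 as the sum of the column lengths matches the two sides column by column,
      -- the factor n i being what separates ∏ n_j! from the product for the smaller shape.
      rw [key.2, Finset.sum_mul, Nat.factorial_succ, ← ht, Finset.sum_mul, Finset.sum_filter]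
      refine Finset.sum_congr rfl fun i hi => ?_
      split_ifs with h
      · have hik := Finset.mem_range.1 hi
        rw [← (ih (hrk i) (sum_removeStrip ht hik h)).2, ← prod_factorial_removeStrip hik h]
        ring
      · simp [Nat.eq_zero_of_not_pos h]
    · intro a ha
      obtain ⟨i, hi, hv⟩ := exists_bottom_eq ha
      refine ⟨i, Finset.mem_filter.2 ⟨Finset.mem_range.2 ?_, hi⟩, hv⟩
      by_contra hc
      have := hk i (by omega)
      omega
    · intro a ha i hi i' hi' h h'
      exact bottom_unique ha (Finset.mem_filter.1 hi).2 (Finset.mem_filter.1 hi').2 h h'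
    · intro i hi
      exact colStandard_bijOn (Finset.mem_filter.1 hi).2
    · intro i hi
      obtain ⟨hi, hp⟩ := Finset.mem_filter.1 hi
      exact (ih (hrk i) (sum_removeStrip ht (Finset.mem_range.1 hi) hp)).1

lemma antitone_removeStrip_singleton {n : ℕ → ℕ} (hn : Antitone n) {i : ℕ} (hi : n (i + 1) < n i) :
    Antitone (removeStrip n {i}) := by
  refine antitone_nat_of_succ_le fun j => ?_
  have := hn (Nat.le_succ j)
  simp only [Nat.succ_eq_add_one] at this
  simp only [removeStrip, Finset.mem_singleton]
  rcases eq_or_ne j i with rfl | h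
  · simp
    omega
  · simp only [h, if_false]
    omega

/-- Removing t + 1 sums over the corners of the shape, while `sum_detInvFact_sub_one` sums over all
columns with total factor ∑ n_j = t + 1; the determinants at non-corners are zero. -/
theorem ncard_standard {k : ℕ} (t : ℕ) {n : ℕ → ℕ} (hn : Antitone n) (hk : ∀ j, k ≤ j → n j = 0)
    (ht : ∑ j ∈ Finset.range k, n j = t) :
    ((standard t n).ncard : ℝ) = t.factorial * detInvFact k fun j => n j := by
  induction t generalizing n with
  | zero =>
    obtain ⟨hn0, h⟩ := colStandard_zero hk ht
    have h1 : standard 0 n = {fun _ _ => 0} := by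
      rw [standard, h]
      ext a
      simp only [Set.mem_ofPred_eq, hn0, Set.mem_singleton_iff]
      simp
    -- The determinant of the empty shape is read off from the binomial one at N = 0, where the row
    -- and column factors cancel.
    have h2 := detBinom_zero_of_eq_zero k (m := fun j => (n j : ℤ)) (by simp [hn0])
    rw [detBinom_eq_mul, ← mul_assoc, ← Finset.prod_mul_distrib] at h2
    rw [h1, Set.ncard_singleton, Nat.cast_one, ← h2]
    simp only [hn0]
    rw [Finset.prod_eq_one]
    · simp
    · intro j _
      have := Nat.factorial_ne_zero j
      have e : ((0 : ℕ) : ℤ) - ((0 : ℕ) : ℤ) + (j : ℤ) = (j : ℤ) := by simp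
      rw [e, invFact_natCast, zero_add]
      field_simp
  | succ t ih =>
    have hrk : ∀ i j, k ≤ j → removeStrip n {i} j = 0 := by
      intro i j hj
      simp [removeStrip, hk j hj]
    have key := ncard_eq_sum_of_bijOn (S := standard (t + 1) n)
      (T := (Finset.range k).filter fun i => n (i + 1) < n i)
      (fun i a => a (n i - 1) i = t + 1) ?_ ?_
      (R := fun i => standard t (removeStrip n {i})) (fun i => setBottom n {i} 0) ?_ ?_
    · rw [key.2, Nat.factorial_succ]
      have hs := sum_detInvFact_sub_one k fun j => (n j : ℤ)
      have ht' : ∑ r ∈ Finset.range k, (((n r : ℕ) : ℤ) : ℝ) = ((t + 1 : ℕ) : ℝ) := by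
        rw [← ht]
        push_cast
        rfl
      rw [ht'] at hs
      push_cast at hs ⊢
      rw [mul_right_comm, ← hs, Finset.sum_filter, Finset.sum_mul]
      refine Finset.sum_congr rfl fun i hi => ?_
      have hik := Finset.mem_range.1 hi
      split_ifs with h
      · rw [ih (antitone_removeStrip_singleton hn h) (hrk i)
          (sum_removeStrip ht hik (by omega)), mul_comm]
        congr 2
        ext j
        rw [removeStrip_singleton]
        rcases eq_or_ne j i with rfl | hj
        · simp only [Function.update_self]
          omega
        · simp [Function.update_of_ne hj]
      · have h0 := hn (Nat.le_succ i)
        simp only [Nat.succ_eq_add_one] at h0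
        rw [detInvFact_eq_zero _ hik, zero_mul]
        · simp only [Function.update_self, Function.update_of_ne (Nat.succ_ne_self i)]
          rw [← Nat.succ_eq_add_one i] at h h0
          omega
        · simp [Function.update_of_ne hik.ne', hk k le_rfl]
    · intro a ha
      obtain ⟨i, hi, hv⟩ := exists_bottom_eq ha.1
      refine ⟨i, Finset.mem_filter.2 ⟨Finset.mem_range.2 ?_, ?_⟩, hv⟩
      · by_contra hc
        have := hk i (by omega)
        omega
      · by_contra hc
        -- If column i + 1 were as long, the cell to the right of t + 1 would have to exceed t + 1.
        have h1 := ha.2 (n i - 1) i (i + 1) (by omega) (by omega)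
        have h2 := (ha.1.2.1.mapsTo (show ((n i - 1, i + 1) : ℕ × ℕ) ∈
          {c : ℕ × ℕ | c.1 < n c.2} from (by simp only [Set.mem_ofPred_eq]; omega))).2
        simp only at h2
        omega
    · intro a ha i hi i' hi' h h'
      have h1 := (Finset.mem_filter.1 hi).2
      have h2 := (Finset.mem_filter.1 hi').2
      exact bottom_unique ha.1 (by omega) (by omega) h h'
    · intro i hi
      have h1 := (Finset.mem_filter.1 hi).2
      exact standard_bijOn hn (by omega) (antitone_removeStrip_singleton hn h1)
    · intro i hi
      obtain ⟨hi, hp⟩ := Finset.mem_filter.1 hi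
      exact (ncard_colStandard t (hrk i)
        (sum_removeStrip ht (Finset.mem_range.1 hi) (by omega))).1.subset fun a ha => ha.1


/-! ### Counting fillings with independent columns or independent rows. -/

/-- Strictly increasing sequences of length `n` in `{1, …, M}`, extended by zero. -/
def strictSeq (n M : ℕ) : Set (ℕ → ℕ) :=
  {f | (∀ i, n ≤ i → f i = 0) ∧ (∀ i₁ i₂, i₁ < i₂ → i₂ < n → f i₁ < f i₂) ∧
    ∀ i, i < n → 1 ≤ f i ∧ f i ≤ M}

/-- Weakly increasing sequences of length `n` in `{l + 1, …, M}`, extended by zero. -/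
def weakSeq (n l M : ℕ) : Set (ℕ → ℕ) :=
  {f | (∀ i, n ≤ i → f i = 0) ∧ (∀ i₁ i₂, i₁ < i₂ → i₂ < n → f i₁ ≤ f i₂) ∧
    ∀ i, i < n → l < f i ∧ f i ≤ M}

lemma strictSeq_bijOn (n M : ℕ) :
    Set.BijOn (fun f : ℕ → ℕ => (Finset.range n).image f) (strictSeq n M)
      (Finset.powersetCard n (Finset.Icc 1 M) : Set (Finset ℕ)) := by
  have hinj : ∀ f ∈ strictSeq n M, Set.InjOn f (Finset.range n : Set ℕ) := by
    intro f hf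
    refine StrictMonoOn.injOn fun i _ j hj hij => ?_
    exact hf.2.1 i j hij (Finset.mem_range.1 hj)
  refine ⟨fun f hf => ?_, fun f hf g hg h => ?_, fun s hs => ?_⟩
  · rw [Finset.mem_coe, Finset.mem_powersetCard, Finset.card_image_of_injOn (hinj f hf),
      Finset.card_range]
    refine ⟨fun x hx => ?_, rfl⟩
    obtain ⟨i, hi, rfl⟩ := Finset.mem_image.1 hx
    exact Finset.mem_Icc.2 (hf.2.2 i (Finset.mem_range.1 hi))
  · simp only at h
    have hcard : ((Finset.range n).image f).card = n := by
      rw [Finset.card_image_of_injOn (hinj f hf), Finset.card_range]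
    have h1 : (fun i : Fin n => f i) = _ := Finset.orderEmbOfFin_unique hcard
      (fun i => Finset.mem_image_of_mem f (Finset.mem_range.2 i.2))
      (fun i j hij => hf.2.1 i j hij j.2)
    have h2 : (fun i : Fin n => g i) = _ := Finset.orderEmbOfFin_unique hcard
      (fun i => by rw [h]; exact Finset.mem_image_of_mem g (Finset.mem_range.2 i.2))
      (fun i j hij => hg.2.1 i j hij j.2)
    ext i
    rcases Nat.lt_or_ge i n with hi | hi
    · exact congrFun (h1.trans h2.symm) ⟨i, hi⟩
    · rw [hf.1 i hi, hg.1 i hi]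
  · obtain ⟨hs, hcard⟩ := Finset.mem_powersetCard.1 (Finset.mem_coe.1 hs)
    refine ⟨fun i => if h : i < n then s.orderEmbOfFin hcard ⟨i, h⟩ else 0,
      ⟨fun i hi => dif_neg (by omega), fun i j hij hj => ?_, fun i hi => ?_⟩, ?_⟩
    · simp only [hj, hij.trans hj, dif_pos]
      exact (s.orderEmbOfFin hcard).strictMono hij
    · simp only [hi, dif_pos]
      exact Finset.mem_Icc.1 (hs (Finset.orderEmbOfFin_mem s hcard _))
    · refine Finset.eq_of_subset_of_card_le (fun x hx => ?_) ?_
      · obtain ⟨i, hi, rfl⟩ := Finset.mem_image.1 hx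
        simp only [Finset.mem_range.1 hi, dif_pos]
        exact Finset.orderEmbOfFin_mem s hcard _
      · rw [Finset.card_image_of_injOn, hcard, Finset.card_range]
        refine StrictMonoOn.injOn fun i hi j hj hij => ?_
        simp only [Finset.mem_range.1 hi, Finset.mem_range.1 hj, dif_pos]
        exact (s.orderEmbOfFin hcard).strictMono hij

lemma ncard_strictSeq (n M : ℕ) :
    (strictSeq n M).Finite ∧ (strictSeq n M).ncard = M.choose n := by
  have h := strictSeq_bijOn n M
  refine ⟨Set.Finite.of_finite_image (h.image_eq ▸ Finset.finite_toSet _) h.injOn, ?_⟩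
  rw [← h.injOn.ncard_image, h.image_eq, Set.ncard_coe_finset, Finset.card_powersetCard,
    Nat.card_Icc, Nat.add_sub_cancel]

lemma add_le_of_mem_strictSeq {n M : ℕ} {f : ℕ → ℕ} (hf : f ∈ strictSeq n M) {i d : ℕ}
    (h : i + d < n) : f i + d ≤ f (i + d) := by
  induction d with
  | zero => simp
  | succ d ih =>
    have h1 := ih (by omega)
    have h2 := hf.2.1 (i + d) (i + (d + 1)) (by omega) h
    omega

/-- Adding i to the i-th term makes a weakly increasing sequence strict; subtracting l makes it
start at 1 or above. -/
lemma weakSeq_bijOn {n l M : ℕ} (hl : l < M) :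
    Set.BijOn (fun f i => if i < n then f i + i - l else 0) (weakSeq n l M)
      (strictSeq n (M - l + n - 1)) := by
  refine Set.InvOn.bijOn (f' := fun f i => if i < n then f i + l - i else 0) ⟨?_, ?_⟩ ?_ ?_
  · intro f hf
    ext i
    simp only
    split_ifs with h
    · have := hf.2.2 i h
      omega
    · exact (hf.1 i (by omega)).symm
  · intro f hf
    ext i
    simp only
    split_ifs with h
    · have h1 := hf.2.2 0 (by omega)
      have h2 := add_le_of_mem_strictSeq hf (i := 0) (d := i) (by omega)
      rw [zero_add] at h2
      omega
    · exact (hf.1 i (by omega)).symm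
  · intro f hf
    refine ⟨fun i hi => if_neg (by omega), fun i j hij hj => ?_, fun i hi => ?_⟩
    · simp only [hj, hij.trans hj, if_true]
      have h1 := hf.2.1 i j hij hj
      have h2 := hf.2.2 i (hij.trans hj)
      omega
    · simp only [hi, if_true]
      have h2 := hf.2.2 i hi
      omega
  · intro f hf
    refine ⟨fun i hi => if_neg (by omega), fun i j hij hj => ?_, fun i hi => ?_⟩
    · simp only [hj, hij.trans hj, if_true]
      have h2 := add_le_of_mem_strictSeq hf (i := i) (d := j - i) (by omega)
      rw [Nat.add_sub_cancel' hij.le] at h2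
      omega
    · simp only [hi, if_true]
      have h1 := hf.2.2 0 (by omega)
      have h2 := add_le_of_mem_strictSeq hf (i := 0) (d := i) (by omega)
      -- The upper bound on f i comes from the last term, which is at least n - 1 - i larger.
      have h3 := add_le_of_mem_strictSeq hf (i := i) (d := n - 1 - i) (by omega)
      have h4 := hf.2.2 (n - 1) (by omega)
      rw [zero_add] at h2
      have h5 : i + (n - 1 - i) = n - 1 := by omega
      rw [h5] at h3
      omega

lemma ncard_weakSeq {n l M : ℕ} (hl : l < M) :
    (weakSeq n l M).Finite ∧ (weakSeq n l M).ncard = (M - l + n - 1).choose n := by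
  have h := weakSeq_bijOn (n := n) hl
  have hs := ncard_strictSeq n (M - l + n - 1)
  refine ⟨Set.Finite.of_finite_image (h.image_eq ▸ hs.1) h.injOn, ?_⟩
  rw [← h.injOn.ncard_image, h.image_eq, hs.2]

lemma strictSeq_zero (M : ℕ) : strictSeq 0 M = {fun _ => 0} := by
  ext f
  simp [strictSeq, funext_iff]

lemma weakSeq_zero (l M : ℕ) : weakSeq 0 l M = {fun _ => 0} := by
  ext f
  simp [weakSeq, funext_iff]

/-- The equivalence `e` lets one statement serve both columns (swapping the arguments) and rows
(identity). -/
lemma ncard_forall_mem {α : Type*} {k : ℕ} {C : ℕ → Set (ℕ → ℕ)} (e : α ≃ (ℕ → ℕ → ℕ))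
    (hfin : ∀ j, j < k → (C j).Finite) (h0 : ∀ j, k ≤ j → C j = {fun _ => 0}) :
    {a | ∀ j, e a j ∈ C j}.Finite ∧
      {a | ∀ j, e a j ∈ C j}.ncard = ∏ j ∈ Finset.range k, (C j).ncard := by
  classical
  have hb : Set.BijOn (fun a (j : Fin k) => e a j) {a | ∀ j, e a j ∈ C j}
      (Fintype.piFinset fun j : Fin k => (hfin j j.2).toFinset : Set (Fin k → ℕ → ℕ)) := by
    refine ⟨fun a ha => ?_, fun a ha b hb h => ?_, fun f hf => ?_⟩
    · simp only [Finset.mem_coe, Fintype.mem_piFinset, Set.Finite.mem_toFinset]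
      exact fun j => ha j
    · apply e.injective
      ext j : 1
      rcases Nat.lt_or_ge j k with hj | hj
      · exact congrFun h ⟨j, hj⟩
      · have h1 := ha j
        have h2 := hb j
        rw [h0 j hj] at h1 h2
        exact h1.trans h2.symm
    · simp only [Finset.mem_coe, Fintype.mem_piFinset, Set.Finite.mem_toFinset] at hf
      refine ⟨e.symm fun j => if h : j < k then f ⟨j, h⟩ else fun _ => 0, fun j => ?_, ?_⟩
      · rw [Equiv.apply_symm_apply]
        split_ifs with h
        · exact hf ⟨j, h⟩
        · rw [h0 j (by omega)]
          rfl
      · ext j : 1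
        simp
  refine ⟨Set.Finite.of_finite_image (hb.image_eq ▸ Finset.finite_toSet _) hb.injOn, ?_⟩
  rw [← hb.injOn.ncard_image, hb.image_eq, Set.ncard_coe_finset, Fintype.card_piFinset,
    Finset.prod_range]
  exact Finset.prod_congr rfl fun j _ => (Set.ncard_eq_toFinset_card _ _).symm

lemma colLen_eq_zero (μ : YoungDiagram) {j : ℕ} (hj : μ.rowLen 0 ≤ j) : μ.colLen j = 0 := by
  by_contra h
  have : (0, j) ∈ μ := YoungDiagram.mem_iff_lt_colLen.2 (Nat.pos_of_ne_zero h)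
  have := YoungDiagram.mem_iff_lt_rowLen.1 this
  omega

lemma rowLen_eq_zero (μ : YoungDiagram) {i : ℕ} (hi : μ.colLen 0 ≤ i) : μ.rowLen i = 0 := by
  by_contra h
  have : (i, 0) ∈ μ := YoungDiagram.mem_iff_lt_rowLen.2 (Nat.pos_of_ne_zero h)
  have := YoungDiagram.mem_iff_lt_colLen.1 this
  omega

lemma boldSTC_eq (N : ℕ) (μ : YoungDiagram) : boldSTC N μ =
    {a | ∀ j, Equiv.piComm (fun _ _ => ℕ) a j ∈ strictSeq (μ.colLen j) (N + j)} := by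
  ext a
  simp only [boldSTC, IsFilling, ColStrict, strictSeq, Set.mem_ofPred_eq, Equiv.piComm_apply,
    YoungDiagram.mem_iff_lt_colLen, not_lt]
  exact ⟨fun h j => ⟨fun i => h.1 i j, fun i₁ i₂ => h.2.1 i₁ i₂ j, fun i => h.2.2 i j⟩,
    fun h => ⟨fun i j => (h j).1 i, fun i₁ i₂ j => (h j).2.1 i₁ i₂, fun i j => (h j).2.2 i⟩⟩

lemma boldSTR₀_eq (μ : YoungDiagram) : boldSTR₀ μ =
    {a | ∀ i, Equiv.refl (ℕ → ℕ → ℕ) a i ∈ weakSeq (μ.rowLen i) i (μ.colLen 0)} := by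
  ext a
  simp only [boldSTR₀, boldSTR, IsFilling, RowWeak, weakSeq, Set.mem_ofPred_eq,
    Equiv.refl_apply, YoungDiagram.mem_iff_lt_rowLen, not_lt]
  exact ⟨fun h i => ⟨h.1 i, h.2.1 i, h.2.2 i⟩,
    fun h => ⟨fun i => (h i).1, fun i => (h i).2.1, fun i => (h i).2.2⟩⟩

lemma ncard_boldSTC (N : ℕ) (μ : YoungDiagram) :
    (boldSTC N μ).Finite ∧ (boldSTC N μ).ncard =
      ∏ j ∈ Finset.range (μ.rowLen 0), (N + j).choose (μ.colLen j) := by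
  have h := ncard_forall_mem (k := μ.rowLen 0) (C := fun j => strictSeq (μ.colLen j) (N + j))
    (Equiv.piComm fun _ _ => ℕ) (fun j _ => (ncard_strictSeq _ _).1)
    (fun j hj => by rw [colLen_eq_zero μ hj, strictSeq_zero])
  simp only [(ncard_strictSeq _ _).2] at h
  rw [boldSTC_eq]
  exact h

lemma ncard_boldSTR₀ (μ : YoungDiagram) :
    (boldSTR₀ μ).Finite ∧ (boldSTR₀ μ).ncard =
      ∏ i ∈ Finset.range (μ.colLen 0), (μ.colLen 0 - i + μ.rowLen i - 1).choose (μ.rowLen i) := by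
  have h := ncard_forall_mem (k := μ.colLen 0)
    (C := fun i => weakSeq (μ.rowLen i) i (μ.colLen 0))
    (Equiv.refl _) (fun j hj => (ncard_weakSeq hj).1)
    (fun j hj => by rw [rowLen_eq_zero μ hj, weakSeq_zero])
  rw [Finset.prod_congr rfl fun i hi => (ncard_weakSeq (Finset.mem_range.1 hi)).2] at h
  rw [boldSTR₀_eq]
  exact h


/-! ### Hook lengths, the Vandermonde determinant and the two forms of P. -/

lemma prod_sub_mul_sub {A q : ℕ} (hq : q ≤ A) :
    (∏ r ∈ Finset.range q, (A + 1 - r)) * (A + 1 - q) =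
      (∏ r ∈ Finset.range q, (A - r)) * (A + 1) := by
  induction q with
  | zero => simp
  | succ q ih =>
    rw [Finset.prod_range_succ, Finset.prod_range_succ, ih (by omega)]
    have : A + 1 - (q + 1) = A - q := by omega
    rw [this]
    ring

/-- Induction on the number K of columns kept. With A = n i + (K - 1 - i), adding column K changes
the hooks A - r in rows r < n K to A + 1 - r, fixes the others, and adds the difference A + 1 - n K.
By `prod_sub_mul_sub` the net factor is A + 1. -/
lemma prod_hook_column {n : ℕ → ℕ} (hn : Antitone n) {i K : ℕ} (hK : i + 1 ≤ K) :
    (∏ r ∈ Finset.range (n i),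
        (n i - r + ((Finset.Ico (i + 1) K).filter fun j => r < n j).card)) *
      ∏ j ∈ Finset.Ico (i + 1) K, (n i - n j + (j - i)) = (n i + (K - 1 - i)).factorial := by
  induction K, hK using Nat.le_induction with
  | base =>
    have h := Nat.descFactorial_eq_prod_range (n i) (n i)
    rw [Nat.descFactorial_self] at h
    simp [h]
  | succ K hK ih =>
    have hq : n K ≤ n i := hn (by omega)
    have hIco : Finset.Ico (i + 1) (K + 1) = insert K (Finset.Ico (i + 1) K) := by
      ext x
      simp only [Finset.mem_Ico, Finset.mem_insert]
      omega
    have hnot : K ∉ Finset.Ico (i + 1) K := by simp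
    have hcard : ∀ r, ((Finset.Ico (i + 1) (K + 1)).filter fun j => r < n j).card =
        ((Finset.Ico (i + 1) K).filter fun j => r < n j).card + if r < n K then 1 else 0 := by
      intro r
      rw [hIco, Finset.filter_insert]
      split_ifs with h
      · rw [Finset.card_insert_of_notMem (by simp)]
      · simp
    have hfull : ∀ r, r < n K → ((Finset.Ico (i + 1) K).filter fun j => r < n j).card =
        K - 1 - i := by
      intro r hr
      rw [Finset.filter_true_of_mem, Nat.card_Ico]
      · omega
      · intro j hj
        exact hr.trans_le (hn (Finset.mem_Ico.1 hj).2.le)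
    have hsplit := fun f : ℕ → ℕ => Finset.prod_range_mul_prod_Ico f hq
    rw [hIco, Finset.prod_insert hnot, ← hIco, ← hsplit]
    rw [← hsplit] at ih
    have e1 : ∏ r ∈ Finset.range (n K),
        (n i - r + ((Finset.Ico (i + 1) (K + 1)).filter fun j => r < n j).card) =
        ∏ r ∈ Finset.range (n K), (n i + (K - 1 - i) + 1 - r) := by
      refine Finset.prod_congr rfl fun r hr => ?_
      have hr := Finset.mem_range.1 hr
      rw [hcard, hfull r hr, if_pos hr]
      omega
    have e2 : ∏ r ∈ Finset.range (n K),
        (n i - r + ((Finset.Ico (i + 1) K).filter fun j => r < n j).card) =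
        ∏ r ∈ Finset.range (n K), (n i + (K - 1 - i) - r) := by
      refine Finset.prod_congr rfl fun r hr => ?_
      have hr := Finset.mem_range.1 hr
      rw [hfull r hr]
      omega
    have e3 : ∏ r ∈ Finset.Ico (n K) (n i),
        (n i - r + ((Finset.Ico (i + 1) (K + 1)).filter fun j => r < n j).card) =
        ∏ r ∈ Finset.Ico (n K) (n i),
        (n i - r + ((Finset.Ico (i + 1) K).filter fun j => r < n j).card) := by
      refine Finset.prod_congr rfl fun r hr => ?_
      have hr := (Finset.mem_Ico.1 hr).1
      rw [hcard, if_neg (by omega), add_zero]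
    rw [e2] at ih
    rw [e1, e3]
    have e4 : n i + (K + 1 - 1 - i) = n i + (K - 1 - i) + 1 := by omega
    have e5 : n i - n K + (K - i) = n i + (K - 1 - i) + 1 - n K := by omega
    rw [e4, e5, Nat.factorial_succ, ← ih]
    have e6 := prod_sub_mul_sub (A := n i + (K - 1 - i)) (q := n K) (by omega)
    rw [mul_mul_mul_comm, e6]
    ring

lemma prod_add_mul_factorial (n i : ℕ) {K : ℕ} (hK : i + 1 ≤ K) :
    (∏ j ∈ Finset.Ico (i + 1) K, (n + (j - i))) * n.factorial = (n + (K - 1 - i)).factorial := by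
  induction K, hK using Nat.le_induction with
  | base => simp
  | succ K hK ih =>
    rw [Finset.prod_Ico_succ_top hK, mul_right_comm, ih]
    have e : n + (K + 1 - 1 - i) = n + (K - 1 - i) + 1 := by omega
    have e' : n + (K - i) = n + (K - 1 - i) + 1 := by omega
    rw [e, e', Nat.factorial_succ, mul_comm]

lemma prod_range_prod_Ico (k : ℕ) (f : ℕ → ℕ → ℝ) :
    ∏ i ∈ Finset.range k, ∏ j ∈ Finset.Ico (i + 1) k, f i j =
      ∏ j ∈ Finset.range k, ∏ i ∈ Finset.range j, f i j := by
  refine Finset.prod_comm' fun i j => ?_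
  simp only [Finset.mem_range, Finset.mem_Ico]
  omega

/-- Falling factorials are monic of degree equal to their order, so this is a Vandermonde
determinant; degrees decrease along the columns, hence the reversal of both indices. -/
lemma det_descPochhammer (k : ℕ) (l : ℕ → ℝ) :
    (Matrix.of fun i j : Fin k => (descPochhammer ℝ (k - 1 - j)).eval (l i)).det =
      ∏ j ∈ Finset.range k, ∏ i ∈ Finset.range j, (l i - l j) := by
  have h := Matrix.det_eval_matrixOfPolynomials_eq_det_vandermonde
    (fun i : Fin k => l (Fin.rev i)) (fun i => descPochhammer ℝ i)
    (fun i => descPochhammer_natDegree ℝ i) (fun i => monic_descPochhammer ℝ i)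
  rw [← Matrix.det_submatrix_equiv_self Fin.revPerm, Finset.prod_range]
  have e : (Matrix.of fun i j : Fin k => (descPochhammer ℝ (k - 1 - j)).eval (l i)).submatrix
      Fin.revPerm Fin.revPerm =
      Matrix.of fun i j : Fin k => (descPochhammer ℝ j).eval (l (Fin.rev i)) := by
    ext i j
    simp only [Matrix.submatrix_apply, Matrix.of_apply, Fin.revPerm_apply]
    congr 2
    rw [Fin.val_rev]
    omega
  rw [e, ← h, Matrix.det_vandermonde, ← Equiv.prod_comp Fin.revPerm]
  refine Finset.prod_congr rfl fun i _ => ?_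
  rw [Fin.revPerm_apply, Fin.rev_rev]
  refine Finset.prod_bij (fun j _ => (Fin.rev j : ℕ)) ?_ ?_ ?_ ?_
  · intro j hj
    have := Finset.mem_Ioi.1 hj
    rw [Finset.mem_range]
    have h1 : Fin.rev j < i := by
      rw [← Fin.rev_rev i]
      exact Fin.rev_lt_rev.2 this
    exact h1
  · intro a _ b _ hab
    exact Fin.rev_injective (Fin.ext hab)
  · intro b hb
    have hb := Finset.mem_range.1 hb
    refine ⟨Fin.rev ⟨b, hb.trans i.2⟩, Finset.mem_Ioi.2 (Fin.rev_lt_rev.2 hb), ?_⟩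
    rw [Fin.rev_rev]
  · intro j _
    rfl

lemma detInvFact_mul_prod (k : ℕ) (n : ℕ → ℕ) :
    (∏ i ∈ Finset.range k, ((n i + (k - 1 - i)).factorial : ℝ)) * detInvFact k (fun j => n j) =
      ∏ j ∈ Finset.range k, ∏ i ∈ Finset.range j, ((n i : ℝ) - n j + j - i) := by
  have h := det_descPochhammer k fun i => ((n i + (k - 1 - i) : ℕ) : ℝ)
  have e : ∏ j ∈ Finset.range k, ∏ i ∈ Finset.range j, ((n i : ℝ) - n j + j - i) =
      ∏ j ∈ Finset.range k, ∏ i ∈ Finset.range j,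
        (((n i + (k - 1 - i) : ℕ) : ℝ) - ((n j + (k - 1 - j) : ℕ) : ℝ)) := by
    refine Finset.prod_congr rfl fun j hj => Finset.prod_congr rfl fun i hi => ?_
    have hj := Finset.mem_range.1 hj
    have hi := Finset.mem_range.1 hi
    have e : k - 1 - i = (k - 1 - j) + (j - i) := by omega
    rw [e]
    push_cast [hi.le]
    ring
  rw [e, ← h, detInvFact, Finset.prod_range, ← Matrix.det_mul_column]
  congr 1
  ext i j
  simp only [shiftMat, Matrix.of_apply]
  rw [descPochhammer_eval_eq_descFactorial]
  have hi := i.2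
  have hj := j.2
  -- If n i - i + j is negative, the reciprocal factorial and the falling factorial both vanish;
  -- otherwise the entry is l! / (l - (k - 1 - j))! with l = n i + (k - 1 - i).
  rcases Nat.lt_or_ge (n i + j) i with hlt | hge
  · rw [invFact_of_neg (by omega), Nat.descFactorial_eq_zero_iff_lt.2 (by omega)]
    simp
  · obtain ⟨m, hm⟩ := Nat.exists_eq_add_of_le hge
    have e1 : (n i : ℤ) - (i : ℕ) + (j : ℕ) = (m : ℤ) := by omega
    have e2 : n i + (k - 1 - i) = m + (k - 1 - j) := by omega
    rw [e1, invFact_natCast, e2, ← Nat.factorial_mul_descFactorial (Nat.le_add_left _ _),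
      Nat.add_sub_cancel]
    have := Nat.factorial_ne_zero m
    push_cast
    field_simp

lemma prod_cells {M : Type*} [CommMonoid M] (μ : YoungDiagram) (f : ℕ × ℕ → M) :
    ∏ c ∈ μ.cells, f c =
      ∏ j ∈ Finset.range (μ.rowLen 0), ∏ i ∈ Finset.range (μ.colLen j), f (i, j) := by
  refine Finset.prod_finset_product_right _ _ _ fun p => ?_
  rw [Finset.mem_range, Finset.mem_range, YoungDiagram.mem_cells,
    ← YoungDiagram.mem_iff_lt_colLen]
  refine ⟨fun h => ⟨?_, h⟩, fun h => h.2⟩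
  exact YoungDiagram.mem_iff_lt_rowLen.1 (μ.up_left_mem (Nat.zero_le _) le_rfl h)

lemma card_eq_sum_colLen (μ : YoungDiagram) :
    ∑ j ∈ Finset.range (μ.rowLen 0), μ.colLen j = μ.card := by
  -- Passing to `Multiplicative` turns the product over cells into a count.
  have h := prod_cells μ fun _ => Multiplicative.ofAdd 1
  have h' := congrArg Multiplicative.toAdd h
  simpa [toAdd_prod, eq_comm] using h'

lemma colLen_antitone (μ : YoungDiagram) : Antitone μ.colLen := fun i j h => μ.colLen_anti i j h

lemma card_hook (μ : YoungDiagram) {r i : ℕ} (hr : r < μ.colLen i) :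
    (hook μ (r, i)).card = μ.colLen i - r +
      ((Finset.Ico (i + 1) (μ.rowLen 0)).filter fun j => r < μ.colLen j).card := by
  have h : hook μ (r, i) = (Finset.Ico r (μ.colLen i)) ×ˢ {i} ∪
      {r} ×ˢ ((Finset.Ico (i + 1) (μ.rowLen 0)).filter fun j => r < μ.colLen j) := by
    ext ⟨x, y⟩
    have hy : x < μ.colLen y → y < μ.rowLen 0 := by
      intro h
      by_contra hc
      rw [colLen_eq_zero μ (not_lt.1 hc)] at h
      omega
    simp only [hook, Finset.mem_filter, YoungDiagram.mem_cells, YoungDiagram.mem_iff_lt_colLen,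
      Finset.mem_union, Finset.mem_product, Finset.mem_Ico, Finset.mem_singleton]
    constructor
    · rintro ⟨h1, ⟨rfl, h2⟩ | ⟨rfl, h2⟩⟩
      · rcases h2.eq_or_lt with rfl | h2
        · exact Or.inl ⟨⟨le_rfl, h1⟩, rfl⟩
        · exact Or.inr ⟨rfl, ⟨h2, hy h1⟩, h1⟩
      · exact Or.inl ⟨⟨h2, h1⟩, rfl⟩
    · rintro (⟨⟨h1, h2⟩, rfl⟩ | ⟨rfl, ⟨h1, -⟩, h2⟩)
      · exact ⟨h2, Or.inr ⟨rfl, h1⟩⟩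
      · exact ⟨h2, Or.inl ⟨rfl, by omega⟩⟩
  rw [h, Finset.card_union_of_disjoint]
  · simp
  · rw [Finset.disjoint_left]
    rintro ⟨x, y⟩ h1 h2
    simp only [Finset.mem_product, Finset.mem_Ico, Finset.mem_singleton, Finset.mem_filter]
      at h1 h2
    omega

lemma prod_hook_mul (μ : YoungDiagram) :
    (∏ c ∈ μ.cells, ((hook μ c).card : ℝ)) *
      ∏ j ∈ Finset.range (μ.rowLen 0), ∏ i ∈ Finset.range j,
        ((μ.colLen i : ℝ) - μ.colLen j + j - i) =
      ∏ i ∈ Finset.range (μ.rowLen 0), ((μ.colLen i + (μ.rowLen 0 - 1 - i)).factorial : ℝ) := by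
  rw [prod_cells, ← prod_range_prod_Ico _ fun i j => ((μ.colLen i : ℝ) - μ.colLen j + j - i),
    ← Finset.prod_mul_distrib]
  refine Finset.prod_congr rfl fun i hi => ?_
  rw [← prod_hook_column (colLen_antitone μ) (Finset.mem_range.1 hi)]
  push_cast
  congr 1
  · refine Finset.prod_congr rfl fun r hr => ?_
    rw [card_hook μ (Finset.mem_range.1 hr)]
    push_cast
    rfl
  · refine Finset.prod_congr rfl fun j hj => ?_
    have hj := (Finset.mem_Ico.1 hj).1
    rw [Nat.cast_sub (colLen_antitone μ (by omega : i ≤ j)), Nat.cast_sub (by omega : i ≤ j)]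
    ring

lemma prod_hook_mul_detInvFact (μ : YoungDiagram) :
    (∏ c ∈ μ.cells, ((hook μ c).card : ℝ)) *
      detInvFact (μ.rowLen 0) (fun j => μ.colLen j) = 1 := by
  have h1 := prod_hook_mul μ
  rw [← detInvFact_mul_prod (μ.rowLen 0) μ.colLen] at h1
  have h0 : ∏ i ∈ Finset.range (μ.rowLen 0),
      ((μ.colLen i + (μ.rowLen 0 - 1 - i)).factorial : ℝ) ≠ 0 :=
    Finset.prod_ne_zero_iff.2 fun i _ => by exact_mod_cast Nat.factorial_ne_zero _
  apply mul_left_cancel₀ h0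
  rw [mul_one, ← mul_assoc, mul_comm _ (∏ c ∈ μ.cells, _), mul_assoc]
  exact h1

lemma P_eq_mul_detInvFact (μ : YoungDiagram) :
    P μ = (∏ j ∈ Finset.range (μ.rowLen 0), ((μ.colLen j).factorial : ℝ)) *
      detInvFact (μ.rowLen 0) (fun j => μ.colLen j) := by
  have h := prod_hook_mul_detInvFact μ
  have h0 := left_ne_zero_of_mul_eq_one h
  rw [P, div_eq_iff h0, mul_assoc, mul_comm (detInvFact _ _), h, mul_one]

lemma P_eq_prod (μ : YoungDiagram) :
    P μ = ∏ j ∈ Finset.range (μ.rowLen 0), ∏ i ∈ Finset.range j,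
      ((μ.colLen i : ℝ) - μ.colLen j + j - i) / ((μ.colLen i : ℝ) + j - i) := by
  simp_rw [Finset.prod_div_distrib]
  rw [← detInvFact_mul_prod, P_eq_mul_detInvFact,
    ← prod_range_prod_Ico _ fun i j => ((μ.colLen i : ℝ) + j - i)]
  have e : ∏ i ∈ Finset.range (μ.rowLen 0), ((μ.colLen i + (μ.rowLen 0 - 1 - i)).factorial : ℝ) =
      (∏ i ∈ Finset.range (μ.rowLen 0), ∏ j ∈ Finset.Ico (i + 1) (μ.rowLen 0),
        ((μ.colLen i : ℝ) + j - i)) *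
      ∏ i ∈ Finset.range (μ.rowLen 0), ((μ.colLen i).factorial : ℝ) := by
    rw [← Finset.prod_mul_distrib]
    refine Finset.prod_congr rfl fun i hi => ?_
    rw [← prod_add_mul_factorial _ i (Finset.mem_range.1 hi)]
    push_cast
    congr 1
    refine Finset.prod_congr rfl fun j hj => ?_
    have hj := (Finset.mem_Ico.1 hj).1
    rw [Nat.cast_sub (by omega : i ≤ j)]
    ring
  have h0 : ∏ i ∈ Finset.range (μ.rowLen 0), ∏ j ∈ Finset.Ico (i + 1) (μ.rowLen 0),
        ((μ.colLen i : ℝ) + j - i) ≠ 0 := by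
    refine Finset.prod_ne_zero_iff.2 fun i _ => Finset.prod_ne_zero_iff.2 fun j hj => ?_
    have hj := (Finset.mem_Ico.1 hj).1
    have : (i : ℝ) < j := by exact_mod_cast hj
    have : (0 : ℝ) ≤ μ.colLen i := Nat.cast_nonneg _
    exact ne_of_gt (by linarith)
  rw [e]
  field_simp

/-! ### The three probabilities. -/

lemma Pr_eq_div {S A : Set (ℕ → ℕ → ℕ)} (hS : S.Finite) (hA : A ⊆ S) :
    Pr S A = (A.ncard : ℝ) / S.ncard := by
  have hAf := hS.subset hA
  rw [Pr, Measure.real, uniformOn, cond_apply hS.measurableSet, Set.inter_eq_right.2 hA,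
    Measure.count_apply_finite _ hS, Measure.count_apply_finite _ hAf,
    Set.ncard_eq_toFinset_card _ hS, Set.ncard_eq_toFinset_card _ hAf]
  simp [div_eq_inv_mul]

lemma ST_eq (N : ℕ) (μ : YoungDiagram) : ST N μ = semistandard N μ.colLen := by
  ext a
  simp only [ST, semistandard, Set.mem_ofPred_eq, ← YoungDiagram.mem_iff_lt_colLen]
  constructor
  · rintro ⟨⟨T, rfl⟩, h⟩
    exact ⟨fun i j hij => T.zeros' (mt YoungDiagram.mem_iff_lt_colLen.1 (not_lt.2 hij)),
      fun i j₁ j₂ => T.row_weak', fun i₁ i₂ j => T.col_strict', h⟩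
  · rintro ⟨h1, h2, h3, h4⟩
    exact ⟨⟨⟨a, fun {i j₁ j₂} => h2 i j₁ j₂, fun {i₁ i₂ j} => h3 i₁ i₂ j,
      fun {i j} h => h1 i j (not_lt.1 (mt YoungDiagram.mem_iff_lt_colLen.2 h))⟩,
      rfl⟩, h4⟩

lemma boldSTstar_eq (μ : YoungDiagram) : boldSTstar μ = colStandard μ.card μ.colLen := by
  have hc : (μ.cells : Set (ℕ × ℕ)) = {c | c.1 < μ.colLen c.2} := by
    ext ⟨i, j⟩
    simp [YoungDiagram.mem_iff_lt_colLen]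
  ext a
  simp only [boldSTstar, colStandard, IsFilling, UsesEachOnce, ColStrict, Set.mem_ofPred_eq,
    YoungDiagram.mem_iff_lt_colLen, hc, not_lt]

lemma STstar_eq (μ : YoungDiagram) : STstar μ = standard μ.card μ.colLen := by
  ext a
  rw [standard, ← boldSTstar_eq]
  simp only [STstar, boldSTstar, RowStrict, Set.mem_ofPred_eq, YoungDiagram.mem_iff_lt_colLen]
  tauto

lemma ncard_ST {N : ℕ} {μ : YoungDiagram} (hN : μ.colLen 0 ≤ N) :
    ((ST N μ).ncard : ℝ) =
      (∏ j ∈ Finset.range (μ.rowLen 0), ((N + j).descFactorial (μ.colLen j) : ℝ)) *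
        detInvFact (μ.rowLen 0) (fun j => μ.colLen j) := by
  rw [ST_eq, (ncard_semistandard N (colLen_antitone μ) fun j => colLen_eq_zero μ).2,
    detBinom_eq_mul, ← mul_assoc, ← Finset.prod_mul_distrib]
  congr 1
  refine Finset.prod_congr rfl fun j _ => ?_
  -- Here `hN` makes N - n_j + j nonnegative, so its reciprocal factorial is a genuine one and the
  -- factor is a falling factorial.
  have hj : μ.colLen j ≤ N + j := (colLen_antitone μ (Nat.zero_le j)).trans (by omega)
  have e : (N : ℤ) - μ.colLen j + j = ((N + j - μ.colLen j : ℕ) : ℤ) := by omega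
  rw [e, invFact_natCast, ← Nat.factorial_mul_descFactorial hj]
  have := Nat.factorial_ne_zero (N + j - μ.colLen j)
  push_cast
  field_simp

lemma Pr_boldSTC_ST {N : ℕ} {μ : YoungDiagram} (hN : μ.colLen 0 ≤ N) :
    Pr (boldSTC N μ) (ST N μ) = P μ := by
  obtain ⟨hf, hc⟩ := ncard_boldSTC N μ
  rw [Pr_eq_div hf, ncard_ST hN, hc, P_eq_mul_detInvFact]
  · simp_rw [Nat.descFactorial_eq_factorial_mul_choose]
    push_cast
    rw [Finset.prod_mul_distrib]
    have h0 : ∏ j ∈ Finset.range (μ.rowLen 0), ((N + j).choose (μ.colLen j) : ℝ) ≠ 0 := by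
      refine Finset.prod_ne_zero_iff.2 fun j _ => ?_
      have hj : μ.colLen j ≤ N + j := (colLen_antitone μ (Nat.zero_le j)).trans (by omega)
      exact_mod_cast (Nat.choose_pos hj).ne'
    field_simp
  · rw [ST_eq]
    rintro a ⟨h1, h2, h3, h4⟩
    refine ⟨fun i j hij => h1 i j ?_, fun i₁ i₂ j hi h => h3 i₁ i₂ j hi ?_, fun i j h => ?_⟩
    · exact not_lt.1 (mt YoungDiagram.mem_iff_lt_colLen.2 hij)
    · exact YoungDiagram.mem_iff_lt_colLen.1 h
    · have := h4 i j (YoungDiagram.mem_iff_lt_colLen.1 h)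
      omega

lemma Pr_boldSTstar_STstar (μ : YoungDiagram) : Pr (boldSTstar μ) (STstar μ) = P μ := by
  obtain ⟨hf, hc⟩ := ncard_colStandard μ.card (fun j => colLen_eq_zero μ) (card_eq_sum_colLen μ)
  have hs := ncard_standard μ.card (colLen_antitone μ) (fun j => colLen_eq_zero μ)
    (card_eq_sum_colLen μ)
  rw [boldSTstar_eq, STstar_eq, Pr_eq_div hf fun a ha => ha.1, hs, P_eq_mul_detInvFact, ← hc]
  have h0 : ((colStandard μ.card μ.colLen).ncard : ℝ) ≠ 0 := by
    have := Nat.factorial_ne_zero μ.card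
    rw [← hc] at this
    exact_mod_cast left_ne_zero_of_mul this
  push_cast
  field_simp

lemma card_hook_transpose (μ : YoungDiagram) (i j : ℕ) :
    (hook μ.transpose (j, i)).card = (hook μ (i, j)).card := by
  refine Finset.card_nbij' Prod.swap Prod.swap ?_ ?_ (fun _ _ => rfl) (fun _ _ => rfl)
  all_goals
    rintro ⟨x, y⟩ h
    simp only [hook, Finset.coe_filter, Set.mem_ofPred_eq, YoungDiagram.mem_cells, Prod.swap,
      YoungDiagram.mem_transpose] at h ⊢
    tauto

lemma prod_cells_transpose {M : Type*} [CommMonoid M] (μ : YoungDiagram) (f : ℕ × ℕ → M) :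
    ∏ c ∈ μ.transpose.cells, f c = ∏ c ∈ μ.cells, f c.swap := by
  refine Finset.prod_nbij' Prod.swap Prod.swap ?_ ?_ (fun _ _ => rfl) (fun _ _ => rfl)
    (fun _ _ => rfl)
  all_goals
    rintro ⟨x, y⟩ h
    simpa using h

/-- Both determinants are reciprocals of hook products, and transposition permutes the hooks without
changing their sizes. -/
lemma detInvFact_transpose (μ : YoungDiagram) :
    detInvFact (μ.transpose.rowLen 0) (fun j => μ.transpose.colLen j) =
      detInvFact (μ.rowLen 0) fun j => μ.colLen j := by
  have h1 := prod_hook_mul_detInvFact μ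
  have h2 := prod_hook_mul_detInvFact μ.transpose
  rw [prod_cells_transpose] at h2
  simp only [Prod.swap, card_hook_transpose] at h2
  exact mul_left_cancel₀ (left_ne_zero_of_mul_eq_one h1) (h2.trans h1.symm)

/-- Both sides are the product of μ.rowLen 0 + i - j over the cells (i, j), taken by rows and by
columns. -/
lemma prod_descFactorial_rowLen (μ : YoungDiagram) :
    ∏ i ∈ Finset.range (μ.colLen 0), (μ.rowLen 0 + i).descFactorial (μ.rowLen i) =
      ∏ j ∈ Finset.range (μ.rowLen 0), (μ.rowLen 0 - j).ascFactorial (μ.colLen j) := by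
  have h1 := prod_cells μ fun c => μ.rowLen 0 + c.1 - c.2
  have h2 := prod_cells μ.transpose fun c => μ.rowLen 0 + c.2 - c.1
  rw [prod_cells_transpose] at h2
  simp only [Prod.fst_swap, Prod.snd_swap, YoungDiagram.rowLen_transpose,
    YoungDiagram.colLen_transpose] at h2
  simp_rw [Nat.descFactorial_eq_prod_range, Nat.ascFactorial_eq_prod_range]
  rw [← h2, h1]
  refine Finset.prod_congr rfl fun j hj => Finset.prod_congr rfl fun i _ => ?_
  have := Finset.mem_range.1 hj
  omega

lemma Pr_boldSTR₀_ST₀_transpose (μ : YoungDiagram) :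
    Pr (boldSTR₀ μ.transpose) (ST₀ μ.transpose) = P μ := by
  obtain ⟨hf, hc⟩ := ncard_boldSTR₀ μ.transpose
  rw [Pr_eq_div hf, ST₀, ncard_ST le_rfl, hc, detInvFact_transpose, P_eq_mul_detInvFact]
  · simp only [YoungDiagram.rowLen_transpose, YoungDiagram.colLen_transpose]
    have h1 := congrArg (Nat.cast (R := ℝ)) (prod_descFactorial_rowLen μ)
    push_cast at h1
    have h2 : ∀ j ∈ Finset.range (μ.rowLen 0),
        ((μ.rowLen 0 - j).ascFactorial (μ.colLen j) : ℝ) = ((μ.colLen j).factorial : ℝ) *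
          ((μ.rowLen 0 - j + μ.colLen j - 1).choose (μ.colLen j) : ℝ) := by
      intro j _
      rw [Nat.ascFactorial_eq_factorial_mul_choose']
      push_cast
      rfl
    rw [h1, Finset.prod_congr rfl h2, Finset.prod_mul_distrib]
    have h0 : ∏ j ∈ Finset.range (μ.rowLen 0),
        ((μ.rowLen 0 - j + μ.colLen j - 1).choose (μ.colLen j) : ℝ) ≠ 0 := by
      refine Finset.prod_ne_zero_iff.2 fun j hj => ?_
      have := Finset.mem_range.1 hj
      exact_mod_cast (Nat.choose_pos (by omega)).ne'
    push_cast
    field_simp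
  · rw [ST₀, ST_eq]
    rintro a ⟨h1, h2, h3, h4⟩
    refine ⟨fun i j hij => h1 i j ?_, fun i j₁ j₂ hj h => h2 i j₁ j₂ hj ?_, fun i j h => ?_⟩
    · exact not_lt.1 (mt YoungDiagram.mem_iff_lt_colLen.2 hij)
    · exact YoungDiagram.mem_iff_lt_colLen.1 h
    · have hij := YoungDiagram.mem_iff_lt_colLen.1 h
      refine ⟨?_, (h4 i j hij).2⟩
      clear h
      -- Positive entries increasing strictly down a column exceed their row index, so the tableaux
      -- satisfy the lower bound imposed on b.
      induction i with
      | zero => exact (h4 0 j hij).1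
      | succ i ih =>
        have := ih (by omega)
        have := h3 i (i + 1) j (by omega) hij
        omega

end YoungFilling
theorem mainTheorem5 (μ : YoungDiagram) (N : ℕ) (hN : μ.colLen 0 ≤ N) :
    YoungFilling.Pr (YoungFilling.boldSTC N μ) (YoungFilling.ST N μ) =
        YoungFilling.Pr (YoungFilling.boldSTR₀ μ.transpose) (YoungFilling.ST₀ μ.transpose) ∧
      YoungFilling.Pr (YoungFilling.boldSTR₀ μ.transpose) (YoungFilling.ST₀ μ.transpose) =
        YoungFilling.Pr (YoungFilling.boldSTstar μ) (YoungFilling.STstar μ) ∧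
      YoungFilling.Pr (YoungFilling.boldSTstar μ) (YoungFilling.STstar μ) = YoungFilling.P μ ∧
      YoungFilling.P μ =
        ∏ j ∈ Finset.range (μ.rowLen 0), ∏ i ∈ Finset.range j,
          ((μ.colLen i : ℝ) - μ.colLen j + j - i) / ((μ.colLen i : ℝ) + j - i) := by
  have h1 := YoungFilling.Pr_boldSTC_ST hN
  have h2 := YoungFilling.Pr_boldSTR₀_ST₀_transpose μ
  have h3 := YoungFilling.Pr_boldSTstar_STstar μ
  exact ⟨h1.trans h2.symm, h2.trans h3.symm, h3, YoungFilling.P_eq_prod μ⟩
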